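/- Let $X_1,X_2,\dots$ be i.i.d. observations with $X_i=Y_i+Z_i$, where $Y_i$ and $Z_i$ are independent, $Y_i$ has a density, $Z_i$ is standard normal, and $\mathrm E X_1^2<\infty$. Let $w$ be a real kernel function whose characteristic function $\phi_w$ is real valued, integrable, symmetric, vanishes outside $[-1,1]$, and satisfies $\phi_w(0)=1$ and $\phi_w(1-t)=At^\alpha+o(t^\alpha)$ as $t\downarrow0$, for some constants $A\in\mathbb R$ and $\alpha\ge 0$. (Here $\phi_w(t)=\int e^{itx}w(x)\,dx$, where for a locally integrable kernel $w$ that is not absolutely integrable, such as $\sin x/(\pi x)$, the integral is understood as $\lim_{T\to\infty}\int_{-T}^{T}$ for almost every $t$.) For a bandwidth $h>0$ and $a<b$ put $$f_{nh}(x)=\frac1{2\pi}\int_{-\infty}^{\infty}e^{-itx}\,\phi_w(ht)\,e^{t^2/2}\,\frac1n\sum_{j=1}^n e^{itX_j}\,dt,\qquad F_{nh}(a,b)=\int_a^b f_{nh}(x)\,dx .$$ Let $b$ be fixed and, as $n\to\infty$, let $h=h_n\to0$ $(h_n>0)$ and $a=a_n\to-\infty$ be such that $ah\to-\infty$ and $a=o\big(e^{(1-\delta)/(2h^2)}\big)$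 for some $0<\delta<1$. Then $F_{nh}(a,b)$ is integrable for each $n$ and $$\frac{\sqrt n}{h^{2+2\alpha}e^{1/(2h^2)}}\,\bigl(F_{nh}(a,b)-\mathrm E\,F_{nh}(a,b)\bigr)\ \xrightarrow{\ \mathcal D\ }\ N\Bigl(0,\ \frac{A^2}{2\pi^2}\,\Gamma(\alpha+1)^2\Bigr).$$ For $A=0$ the limit is the point mass at $0$. -/

import Mathlib

open MeasureTheory ProbabilityTheory Filter Topology Asymptotics

noncomputable section

namespace Deconvolution

/-- `φ` is the characteristic function `t ↦ ∫ e^{itx} w(x) dx` of the kernel `w`. The integral is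
the improper one, `lim_{T → ∞} ∫_{-T}^{T}`, for almost every `t`, so that kernels such as
`sin x / (π x)` are allowed, which are not absolutely integrable and whose characteristic function
has jumps. If `w` is integrable this is the usual characteristic function. Integrability of `φ`
makes the integral that defines the deconvolution estimator exist; it is automatic when `w` is
integrable and `φ` is the usual characteristic function, with bounded support. -/
structure IsKernelCharFun (w φ : ℝ → ℝ) : Prop where
  locallyIntegrable : LocallyIntegrable w
  integrable : Integrable φ
  tendsto : ∀ᵐ t : ℝ, Tendsto
    (fun T : ℝ => ∫ x in (-T)..T, Complex.exp (Complex.I * t * x) * (w x : ℂ))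
    atTop (𝓝 (φ t : ℂ))

/-- The condition on the (real valued) characteristic function `φ` of the kernel: it is symmetric,
supported in `[-1, 1]`, `φ 0 = 1`, and `φ (1 - t) = A t ^ α + o(t ^ α)` as `t ↓ 0`, with `0 ≤ α`. -/
structure ConditionW (φ : ℝ → ℝ) (A α : ℝ) : Prop where
  symm : ∀ t, φ (-t) = φ t
  support : ∀ t, t ∉ Set.Icc (-1 : ℝ) 1 → φ t = 0
  zero : φ 0 = 1
  nonneg : 0 ≤ α
  expansion : (fun t : ℝ => φ (1 - t) - A * t ^ α) =o[𝓝[>] 0] fun t : ℝ => t ^ α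

/-- The empirical characteristic function `(1/n) ∑_j e^{i t x_j}` of the sample
`x 0, …, x (n - 1)`. -/
def empCharFun (n : ℕ) (x : ℕ → ℝ) (t : ℝ) : ℂ :=
  (1 / (n : ℂ)) * ∑ j ∈ Finset.range n, Complex.exp (Complex.I * t * x j)

/-- The integral that defines the density estimator at `u`,
`(1/2π) ∫ e^{-itu} φ_w(ht) φ_emp(t) / φ_k(t) dt`, as a complex number. Here `φ` is the
characteristic function of the kernel and `ν` is the known law of the errors. -/
def densityEstimatorC (φ : ℝ → ℝ) (ν : Measure ℝ) (n : ℕ) (h : ℝ) (x : ℕ → ℝ) (u : ℝ) : ℂ :=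
  (1 / (2 * (Real.pi : ℂ))) *
    ∫ t : ℝ, Complex.exp (-(Complex.I * t * u)) *
      ((φ (h * t) : ℂ) * empCharFun n x t / charFun ν t)

/-- The density estimator `f_{nh}(u)` as a real number. The integral above is real
when `φ` is symmetric, see `coe_densityEstimator`. -/
def densityEstimator (φ : ℝ → ℝ) (ν : Measure ℝ) (n : ℕ) (h : ℝ) (x : ℕ → ℝ) (u : ℝ) : ℝ :=
  (densityEstimatorC φ ν n h x u).re

theorem coe_densityEstimator {φ : ℝ → ℝ} (hφ : ∀ t, φ (-t) = φ t) (ν : Measure ℝ) (n : ℕ) (h : ℝ)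
    (x : ℕ → ℝ) (u : ℝ) :
    (densityEstimator φ ν n h x u : ℂ) = densityEstimatorC φ ν n h x u := by
  have hemp : ∀ t, empCharFun n x (-t) = (starRingEnd ℂ) (empCharFun n x t) := by
    intro t
    simp [empCharFun, ← Complex.exp_conj]
  have key : (starRingEnd ℂ) (densityEstimatorC φ ν n h x u) = densityEstimatorC φ ν n h x u := by
    unfold densityEstimatorC
    rw [map_mul, ← integral_conj]
    congr 1
    · simp [Complex.conj_ofNat]
    · rw [← integral_neg_eq_self]
      congr 1
      funext t
      simp [hφ, hemp, charFun_neg, ← Complex.exp_conj]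
  exact Complex.conj_eq_iff_re.mp key

/-- The estimator `F_{nh}(a, b) = ∫_a^b f_{nh}(u) du` of `P(a < Y ≤ b)`. -/
def intervalEstimator (φ : ℝ → ℝ) (ν : Measure ℝ) (n : ℕ) (h a b : ℝ) (x : ℕ → ℝ) : ℝ :=
  ∫ u in a..b, densityEstimator φ ν n h x u

end Deconvolution

end

/-! Dividing by the Gaussian characteristic function multiplies by `exp (t ^ 2 / 2)`. Fubini then
turns the estimator into a sample mean of differences of `S y = ∫₀¹ φ s * exp (s² / (2h²)) * sin (s
y) / s`, taken at `y = (x - a) / h` and `y = (x - b) / h` and divided by `π`. The exponential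
concentrates the mass near `s = 1` on the scale `h²`. Putting `s = 1 - h² v` turns the exponent into
`1 / (2h²) - v + h² v² / 2` and `φ s` into about `A h^(2α) v^α`. Hence `S y` is close to `rate α h *
A * ∫ v^α e^(-v) sin ((1 - h² v) y) dv`, where the error at `s` away from zero is uniform in `y`
(`exists_sineTransform_bound`).

At the fixed end point, `h² y = h (x - b)` tends to `0`, which leaves `A Γ(α+1) sin ((x - b) / h)`.
At the escaping one, `h² y = h (x - a)` tends to infinity and the Riemann-Lebesgue lemma removes the
term. Near `s = 0` only `|sin (s y) / s| ≤ |y|` is available, and the growth condition on `a`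
absorbs this factor.

So each normalised summand is a bounded sinusoid of frequency `1 / h` plus a remainder that vanishes
in `L²`. The characteristic function of `X` decays because of the Gaussian component, so the
variance of `sin ((X - b) / h)` tends to `1 / 2`. A bounded triangular-array central limit theorem,
Chebyshev's inequality for the remainders and Slutsky's lemma finish the proof. -/

namespace Deconvolution

open Set

/-! ### The estimator as a sample mean of sine transforms. -/

/-- The weighted sine transform of the kernel in terms of which the estimator is expressed. -/
noncomputable def sineTransform (φ : ℝ → ℝ) (h y : ℝ) : ℝ :=
  ∫ s in Ioo (0 : ℝ) 1, φ s * Real.exp (s ^ 2 / (2 * h ^ 2)) * (Real.sin (s * y) / s)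

/-- The contribution of one observation `x` to `intervalEstimator`, for standard normal errors. -/
noncomputable def summand (φ : ℝ → ℝ) (h a b x : ℝ) : ℝ :=
  (1 / Real.pi) * (sineTransform φ h ((x - a) / h) - sineTransform φ h ((x - b) / h))

theorem abs_sin_mul_div_le (s y : ℝ) : |Real.sin (s * y) / s| ≤ |y| := by
  rcases eq_or_ne s 0 with rfl | hs
  · simp
  · rw [abs_div, div_le_iff₀ (abs_pos.mpr hs), ← abs_mul, mul_comm y]
    exact Real.abs_sin_le_abs

/-- The support condition confines `t` to `|t| ≤ 1 / h`, where the exponential is bounded. -/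
theorem integrable_weight {φ : ℝ → ℝ} (hφ : Integrable φ)
    (hsupp : ∀ t, t ∉ Icc (-1 : ℝ) 1 → φ t = 0) {h : ℝ} (hh : 0 < h) :
    Integrable fun t => φ (h * t) * Real.exp (t ^ 2 / 2) := by
  refine ((hφ.comp_mul_left' hh.ne').norm.mul_const (Real.exp ((1 / h) ^ 2 / 2))).mono'
    ((hφ.comp_mul_left' hh.ne').aestronglyMeasurable.mul
      (by fun_prop : Continuous fun t : ℝ => Real.exp (t ^ 2 / 2)).aestronglyMeasurable) ?_
  refine Eventually.of_forall fun t => ?_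
  by_cases ht : h * t ∈ Icc (-1 : ℝ) 1
  · rw [norm_mul]
    gcongr
    rw [Real.norm_eq_abs, Real.abs_exp, Real.exp_le_exp]
    gcongr ?_ / 2
    refine sq_le_sq' ?_ ?_
    · rw [← neg_div, div_le_iff₀ hh]; nlinarith [ht.1]
    · rw [le_div_iff₀ hh]; nlinarith [ht.2]
  · simp [hsupp _ ht]

theorem integrable_weight_mul {φ : ℝ → ℝ} (hφ : Integrable φ)
    (hsupp : ∀ t, t ∉ Icc (-1 : ℝ) 1 → φ t = 0) {h : ℝ} (hh : 0 < h) {g : ℝ → ℝ}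
    (hg : Measurable g) {C : ℝ} (hC : ∀ t, |g t| ≤ C) :
    Integrable fun t => φ (h * t) * Real.exp (t ^ 2 / 2) * g t :=
  (integrable_weight hφ hsupp hh).mul_bdd hg.aestronglyMeasurable
    (Eventually.of_forall hC)

theorem densityEstimator_gaussian {φ : ℝ → ℝ} (hφ : Integrable φ)
    (hsupp : ∀ t, t ∉ Icc (-1 : ℝ) 1 → φ t = 0) {h : ℝ} (hh : 0 < h) (n : ℕ) (x : ℕ → ℝ) (u : ℝ) :
    densityEstimator φ (gaussianReal 0 1) n h x u =
      (1 / (n : ℝ)) * ∑ j ∈ Finset.range n, (1 / (2 * Real.pi)) *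
        ∫ t, φ (h * t) * Real.exp (t ^ 2 / 2) * Real.cos (t * (x j - u)) := by
  have hint (j : ℕ) : Integrable fun t : ℝ =>
      ((φ (h * t) * Real.exp (t ^ 2 / 2) : ℝ) : ℂ) *
        Complex.exp (((t * (x j - u) : ℝ) : ℂ) * Complex.I) := by
    refine (integrable_weight hφ hsupp hh).ofReal.mul_bdd (c := 1)
      (Continuous.aestronglyMeasurable (by fun_prop)) (Eventually.of_forall fun t => ?_)
    rw [Complex.norm_exp_ofReal_mul_I]
  have hre (j : ℕ) : (∫ t : ℝ, ((φ (h * t) * Real.exp (t ^ 2 / 2) : ℝ) : ℂ) *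
        Complex.exp (((t * (x j - u) : ℝ) : ℂ) * Complex.I)).re =
      ∫ t, φ (h * t) * Real.exp (t ^ 2 / 2) * Real.cos (t * (x j - u)) := by
    rw [← RCLike.re_eq_complex_re, ← integral_re (hint j)]
    refine integral_congr_ae (Eventually.of_forall fun t => ?_)
    simp only [RCLike.re_eq_complex_re, Complex.re_ofReal_mul, Complex.exp_ofReal_mul_I_re]
  have hC : densityEstimatorC φ (gaussianReal 0 1) n h x u =
      ((1 / (n : ℝ) : ℝ) : ℂ) * ∑ j ∈ Finset.range n, ((1 / (2 * Real.pi) : ℝ) : ℂ) *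
        ∫ t : ℝ, ((φ (h * t) * Real.exp (t ^ 2 / 2) : ℝ) : ℂ) *
          Complex.exp (((t * (x j - u) : ℝ) : ℂ) * Complex.I) := by
    rw [← Finset.mul_sum, ← integral_finsetSum _ fun j _ => hint j, mul_left_comm,
      ← integral_const_mul]
    unfold densityEstimatorC
    push_cast
    congr 1
    refine integral_congr_ae (Eventually.of_forall fun t => ?_)
    simp only [empCharFun, charFun_gaussianReal]
    rw [div_eq_mul_inv, ← Complex.exp_neg]
    simp only [Finset.mul_sum, Finset.sum_mul]
    refine Finset.sum_congr rfl fun j _ => ?_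
    have e1 : -((t : ℂ) * ((0 : ℝ) : ℂ) * Complex.I - ((1 : NNReal) : ℂ) * (t : ℂ) ^ 2 / 2)
        = (t : ℂ) ^ 2 / 2 := by simp
    have e2 : (t : ℂ) * (x j - u) * Complex.I =
        -(Complex.I * t * u) + Complex.I * t * x j := by ring
    rw [e1, e2, Complex.exp_add]
    ring
  rw [densityEstimator, hC, Complex.re_ofReal_mul, Complex.re_sum]
  congr 1
  refine Finset.sum_congr rfl fun j _ => ?_
  rw [Complex.re_ofReal_mul, hre]

/-- The integrand is even, which gives the factor 2. In the substitution `s = h t` the Jacobian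
cancels against the factor `1 / s`. -/
theorem integral_weight_mul_sin_div {φ : ℝ → ℝ} (hsymm : ∀ t, φ (-t) = φ t)
    (hsupp : ∀ t, t ∉ Icc (-1 : ℝ) 1 → φ t = 0) {h : ℝ} (hh : 0 < h) (z : ℝ) :
    ∫ t, φ (h * t) * Real.exp (t ^ 2 / 2) * (Real.sin (t * z) / t) =
      2 * sineTransform φ h (z / h) := by
  have habs : ∀ t, φ |t| = φ t := fun t => by
    rcases abs_choice t with e | e <;> rw [e]
    exact hsymm t
  have h1 : ∫ t, φ (h * t) * Real.exp (t ^ 2 / 2) * (Real.sin (t * z) / t) =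
      2 * ∫ t in Ioi (0 : ℝ), φ (h * t) * Real.exp (t ^ 2 / 2) * (Real.sin (t * z) / t) := by
    rw [← integral_comp_abs (f := fun t =>
      φ (h * t) * Real.exp (t ^ 2 / 2) * (Real.sin (t * z) / t))]
    refine integral_congr_ae (Eventually.of_forall fun t => ?_)
    have e1 : φ (h * |t|) = φ (h * t) := by
      rw [← habs (h * t), abs_mul, abs_of_pos hh]
    simp only [e1, sq_abs]
    rcases abs_choice t with e | e <;> rw [e]
    rw [neg_mul, Real.sin_neg, neg_div_neg_eq]
  rw [h1]
  congr 1
  have h2 := integral_comp_mul_left_Ioi (fun s : ℝ =>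
    φ s * Real.exp (s ^ 2 / (2 * h ^ 2)) * (Real.sin (s * (z / h)) / s)) 0 hh
  rw [mul_zero, smul_eq_mul, ← inv_mul_eq_iff_eq_mul₀ (inv_ne_zero hh.ne'), inv_inv,
    ← integral_const_mul] at h2
  have h3 : ∫ t in Ioi (0 : ℝ), φ (h * t) * Real.exp (t ^ 2 / 2) * (Real.sin (t * z) / t) =
      ∫ s in Ioi (0 : ℝ),
        φ s * Real.exp (s ^ 2 / (2 * h ^ 2)) * (Real.sin (s * (z / h)) / s) := by
    rw [← h2]
    refine setIntegral_congr_fun measurableSet_Ioi fun t ht => ?_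
    have ht' : t ≠ 0 := ne_of_gt ht
    have e1 : (h * t) ^ 2 / (2 * h ^ 2) = t ^ 2 / 2 := by field_simp
    have e2 : h * t * (z / h) = t * z := by field_simp
    simp only [e1, e2]
    field_simp
  rw [h3, sineTransform, ← integral_Ioc_eq_integral_Ioo]
  refine setIntegral_eq_of_subset_of_forall_sdiff_eq_zero measurableSet_Ioi
    Ioc_subset_Ioi_self fun s hs => ?_
  rw [hsupp s fun hc => hs.2 ⟨hs.1, hc.2⟩]
  simp

theorem intervalIntegral_cos_mul_sub {t : ℝ} (ht : t ≠ 0) (x a b : ℝ) :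
    ∫ u in a..b, Real.cos (t * (x - u)) =
      Real.sin (t * (x - a)) / t - Real.sin (t * (x - b)) / t := by
  have : ∀ u ∈ uIcc a b, HasDerivAt (fun u => -(Real.sin (t * (x - u)) / t))
      (Real.cos (t * (x - u))) u := fun u _ => by
    refine HasDerivAt.congr_deriv
      ((((hasDerivAt_id u).const_sub x).const_mul t).sin.div_const t).neg ?_
    simp only [id]
    field_simp
  rw [intervalIntegral.integral_eq_sub_of_hasDerivAt this
    (Continuous.intervalIntegrable (by fun_prop) _ _)]
  ring

/-- For standard normal errors the estimator is the sample mean of the summands. -/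
theorem intervalEstimator_gaussian {φ : ℝ → ℝ} (hφ : Integrable φ) (hsymm : ∀ t, φ (-t) = φ t)
    (hsupp : ∀ t, t ∉ Icc (-1 : ℝ) 1 → φ t = 0) {h : ℝ} (hh : 0 < h) (n : ℕ) (a b : ℝ)
    (x : ℕ → ℝ) :
    intervalEstimator φ (gaussianReal 0 1) n h a b x =
      (1 / (n : ℝ)) * ∑ j ∈ Finset.range n, summand φ h a b (x j) := by
  have hprod (z : ℝ) : Integrable (Function.uncurry fun u t =>
      φ (h * t) * Real.exp (t ^ 2 / 2) * Real.cos (t * (z - u)))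
      ((volume.restrict (uIoc a b)).prod volume) := by
    have := (integrableOn_const (μ := volume) (s := uIoc a b) (C := (1 : ℝ))
      (by simp [uIoc])).mul_prod
      (integrable_weight hφ hsupp hh)
    refine (this.mul_bdd (g := fun p : ℝ × ℝ => Real.cos (p.2 * (z - p.1))) (c := 1)
      (Continuous.aestronglyMeasurable (by fun_prop))
      (Eventually.of_forall fun p => Real.abs_cos_le_one _)).congr
      (Eventually.of_forall fun p => ?_)
    simp [Function.uncurry]
  have hswap (z : ℝ) : ∫ u in a..b, (1 / (2 * Real.pi)) *
        ∫ t, φ (h * t) * Real.exp (t ^ 2 / 2) * Real.cos (t * (z - u)) = summand φ h a b z := by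
    rw [intervalIntegral.integral_const_mul, intervalIntegral_integral_swap (hprod z)]
    have e : ∫ t, ∫ u in a..b, φ (h * t) * Real.exp (t ^ 2 / 2) * Real.cos (t * (z - u)) =
        ∫ t, (φ (h * t) * Real.exp (t ^ 2 / 2) * (Real.sin (t * (z - a)) / t) -
          φ (h * t) * Real.exp (t ^ 2 / 2) * (Real.sin (t * (z - b)) / t)) := by
      refine integral_congr_ae ?_
      -- At `t = 0` division by zero breaks the formula for the inner integral, but a single point
      -- is null.
      filter_upwards [compl_mem_ae_iff.mpr (measure_singleton (0 : ℝ))] with t ht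
      rw [intervalIntegral.integral_const_mul, intervalIntegral_cos_mul_sub ht, mul_sub]
    rw [e, integral_sub
        (integrable_weight_mul hφ hsupp hh (by fun_prop) fun t => abs_sin_mul_div_le t _)
        (integrable_weight_mul hφ hsupp hh (by fun_prop) fun t => abs_sin_mul_div_le t _),
      integral_weight_mul_sin_div hsymm hsupp hh, integral_weight_mul_sin_div hsymm hsupp hh,
      summand]
    field_simp
  have hii (z : ℝ) : IntervalIntegrable (fun u => (1 / (2 * Real.pi)) *
      ∫ t, φ (h * t) * Real.exp (t ^ 2 / 2) * Real.cos (t * (z - u))) volume a b :=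
    (intervalIntegrable_iff.mpr (hprod z).integral_prod_left).const_mul _
  simp only [intervalEstimator, densityEstimator_gaussian hφ hsupp hh,
    intervalIntegral.integral_const_mul (1 / (n : ℝ))]
  rw [intervalIntegral.integral_finsetSum fun j _ => hii (x j)]
  simp only [hswap]

/-! ### Regularity of the sine transform. -/

theorem integrableOn_sineTransform {φ : ℝ → ℝ} (hφ : Integrable φ) (h y : ℝ) :
    IntegrableOn (fun s => φ s * Real.exp (s ^ 2 / (2 * h ^ 2)) * (Real.sin (s * y) / s))
      (Ioo 0 1) := by
  have h1 : IntegrableOn (fun s => φ s * Real.exp (s ^ 2 / (2 * h ^ 2))) (Ioo 0 1) :=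
    hφ.integrableOn.mul_continuousOn_of_subset (K := Icc 0 1) (by fun_prop) measurableSet_Ioo
      isCompact_Icc Ioo_subset_Icc_self
  exact h1.mul_bdd (c := |y|) (Measurable.aestronglyMeasurable (by fun_prop))
    (Eventually.of_forall fun s => abs_sin_mul_div_le s y)

theorem continuous_sineTransform {φ : ℝ → ℝ} (hφ : Integrable φ) (h : ℝ) :
    Continuous (sineTransform φ h) := by
  rw [continuous_iff_continuousAt]
  intro y
  have h1 : IntegrableOn (fun s => φ s * Real.exp (s ^ 2 / (2 * h ^ 2))) (Ioo 0 1) :=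
    hφ.integrableOn.mul_continuousOn_of_subset (K := Icc 0 1) (by fun_prop) measurableSet_Ioo
      isCompact_Icc Ioo_subset_Icc_self
  refine continuousAt_of_dominated (bound := fun s =>
    ‖φ s * Real.exp (s ^ 2 / (2 * h ^ 2))‖ * (|y| + 1))
    (Eventually.of_forall fun z => (integrableOn_sineTransform hφ h z).aestronglyMeasurable)
    ?_ (h1.norm.mul_const _) (Eventually.of_forall fun s => by fun_prop)
  filter_upwards [Metric.ball_mem_nhds y one_pos] with z hz
  refine Eventually.of_forall fun s => ?_
  rw [norm_mul _ (_ / _)]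
  gcongr
  refine (abs_sin_mul_div_le s z).trans ?_
  rw [Metric.mem_ball, Real.dist_eq] at hz
  have := abs_sub_abs_le_abs_sub z y
  linarith

/-! ### Laplace asymptotics at the end point `s = 1`. -/

/-- The normalising sequence `h ^ (2 + 2 α) * exp (1 / (2 h ^ 2))` of the estimator. -/
noncomputable def rate (α h : ℝ) : ℝ := h ^ (2 + 2 * α) * Real.exp (1 / (2 * h ^ 2))

/-- The limit of the rescaled sine transform of the kernel near its end point. -/
noncomputable def gammaSine (α h y : ℝ) : ℝ :=
  ∫ v in Ioi (0 : ℝ), v ^ α * Real.exp (-v) * Real.sin ((1 - h ^ 2 * v) * y)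

/-- The kernel with exponential weight, rescaled by `s = 1 - h ^ 2 v` near `s = 1`. -/
noncomputable def rescaled (φ : ℝ → ℝ) (α ε h v : ℝ) : ℝ :=
  (Ioo 0 (ε / h ^ 2)).indicator (fun v => φ (1 - h ^ 2 * v) * h ^ (-(2 * α)) *
    Real.exp (-v + h ^ 2 * v ^ 2 / 2) / (1 - h ^ 2 * v)) v

theorem rate_pos (α : ℝ) {h : ℝ} (hh : 0 < h) : 0 < rate α h := by
  unfold rate; positivity

theorem integrableOn_rpow_mul_exp_neg_mul {α c : ℝ} (hα : 0 ≤ α) (hc : 0 < c) :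
    IntegrableOn (fun v : ℝ => v ^ α * Real.exp (-c * v)) (Ioi 0) := by
  simpa using integrableOn_rpow_mul_exp_neg_mul_rpow (p := 1) (by linarith : -1 < α) one_pos hc

theorem tendsto_rpow_mul_exp_neg_div_sq (p : ℝ) {κ : ℝ} (hκ : 0 < κ) :
    Tendsto (fun h : ℝ => h ^ (-p) * Real.exp (-κ / h ^ 2)) (𝓝[>] 0) (𝓝 0) := by
  have h1 := tendsto_rpow_mul_exp_neg_mul_atTop_nhds_zero (p / 2) κ hκ
  have h2 : Tendsto (fun h : ℝ => (h⁻¹) ^ 2) (𝓝[>] 0) atTop :=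
    (tendsto_pow_atTop two_ne_zero).comp tendsto_inv_nhdsGT_zero
  refine (h1.comp h2).congr' ?_
  filter_upwards [self_mem_nhdsWithin] with h hh
  have hh : 0 < h := hh
  simp only [Function.comp_apply]
  congr 1
  · rw [← Real.rpow_natCast, ← Real.rpow_mul (by positivity), Real.inv_rpow hh.le,
      Real.rpow_neg hh.le]
    congr 2
    push_cast; ring
  · congr 1
    field_simp

/-- For `c < 1` the right side has the form treated by `tendsto_rpow_mul_exp_neg_div_sq`, so every
part of the integral with `s ^ 2 ≤ c` is negligible against the rate. -/
theorem exp_div_rate_eq (α c : ℝ) {h : ℝ} (hh : 0 < h) :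
    Real.exp (c / (2 * h ^ 2)) / rate α h =
      h ^ (-(2 + 2 * α)) * Real.exp (-((1 - c) / 2) / h ^ 2) := by
  rw [rate, Real.rpow_neg hh.le, div_mul_eq_div_div_swap, ← Real.exp_sub, div_eq_inv_mul]
  congr 2
  field_simp
  ring

/-- Supplies the dominating function. On the cutoff `h² v < ε ≤ 1 / 2`, the denominator exceeds `1 /
2`, whence the factor 2, and `h² v² / 2` is at most `v / 4`, so half of the decay `e^(-v)` survives.
-/
theorem norm_rescaled_le {φ : ℝ → ℝ} {α ε C : ℝ} (hε : ε ≤ 1 / 2)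
    (hC : ∀ r ∈ Ioo 0 ε, |φ (1 - r)| ≤ C * r ^ α) (hC0 : 0 ≤ C) {h v : ℝ} (hh : 0 < h)
    (hv : 0 < v) :
    |rescaled φ α ε h v| ≤ 2 * C * (v ^ α * Real.exp (-(1 / 2) * v)) := by
  by_cases hv' : v ∈ Ioo 0 (ε / h ^ 2)
  · have hr : h ^ 2 * v < ε := by
      have := hv'.2
      rwa [lt_div_iff₀ (by positivity), mul_comm] at this
    have hr0 : 0 < h ^ 2 * v := by positivity
    rw [rescaled, indicator_of_mem hv', abs_div, abs_mul, abs_mul, Real.abs_exp,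
      abs_of_pos (by linarith : 0 < 1 - h ^ 2 * v), abs_of_pos (by positivity : 0 < h ^ (-(2 * α))),
      div_le_iff₀ (by linarith)]
    have h1 : |φ (1 - h ^ 2 * v)| * h ^ (-(2 * α)) ≤ C * v ^ α := by
      calc _ ≤ C * (h ^ 2 * v) ^ α * h ^ (-(2 * α)) := by
            gcongr
            exact hC _ ⟨hr0, hr⟩
        _ = C * v ^ α := by
            rw [Real.mul_rpow (by positivity) hv.le, Real.rpow_neg hh.le, Real.rpow_mul hh.le,
              Real.rpow_two]
            field_simp
    have h2 : Real.exp (-v + h ^ 2 * v ^ 2 / 2) ≤ Real.exp (-(1 / 2) * v) := by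
      rw [Real.exp_le_exp]
      nlinarith
    have h3 : 0 ≤ C * v ^ α * Real.exp (-(1 / 2) * v) := by positivity
    calc _ ≤ C * v ^ α * Real.exp (-(1 / 2) * v) := by gcongr
      _ ≤ 2 * C * (v ^ α * Real.exp (-(1 / 2) * v)) * (1 - h ^ 2 * v) := by nlinarith
  · rw [rescaled, indicator_of_notMem hv', abs_zero]
    positivity

theorem aestronglyMeasurable_rescaled {φ : ℝ → ℝ} (hφ : Integrable φ) (α ε : ℝ) {h : ℝ}
    (hh : 0 < h) : AEStronglyMeasurable (rescaled φ α ε h) := by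
  have h1 : Integrable fun v : ℝ => φ (1 - h ^ 2 * v) :=
    (hφ.comp_sub_left 1).comp_mul_left' (by positivity : h ^ 2 ≠ 0)
  refine AEStronglyMeasurable.indicator ?_ measurableSet_Ioo
  refine AEStronglyMeasurable.mul ((h1.aestronglyMeasurable.mul_const _).mul
    (Continuous.aestronglyMeasurable (by fun_prop))) ?_
  exact Measurable.aestronglyMeasurable (by fun_prop)

/-- With `v` fixed, `r = h² v` decreases to `0`, so the expansion of `φ` gives `φ (1 - r) / r^α →
A`, and the cutoff eventually contains `v`. -/
theorem tendsto_rescaled {φ : ℝ → ℝ} {A α ε : ℝ} (hε : 0 < ε)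
    (hexp : (fun t : ℝ => φ (1 - t) - A * t ^ α) =o[𝓝[>] 0] fun t : ℝ => t ^ α)
    {v : ℝ} (hv : 0 < v) :
    Tendsto (fun h => rescaled φ α ε h v) (𝓝[>] 0) (𝓝 (A * (v ^ α * Real.exp (-v)))) := by
  have hsq : Tendsto (fun h : ℝ => h ^ 2 * v) (𝓝[>] 0) (𝓝 0) := by
    have : Tendsto (fun h : ℝ => h ^ 2 * v) (𝓝 0) (𝓝 (0 ^ 2 * v)) :=
      Continuous.tendsto (by fun_prop) 0
    simpa using this.mono_left nhdsWithin_le_nhds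
  have hsq' : Tendsto (fun h : ℝ => h ^ 2 * v) (𝓝[>] 0) (𝓝[>] 0) := by
    refine tendsto_nhdsWithin_iff.mpr ⟨hsq, ?_⟩
    filter_upwards [self_mem_nhdsWithin] with h hh
    have hh : 0 < h := hh
    exact (by positivity : 0 < h ^ 2 * v)
  have h1 : Tendsto (fun r : ℝ => φ (1 - r) / r ^ α) (𝓝[>] 0) (𝓝 A) := by
    have := hexp.tendsto_div_nhds_zero.add_const A
    rw [zero_add] at this
    refine this.congr' ?_
    filter_upwards [self_mem_nhdsWithin] with r hr
    have : r ^ α ≠ 0 := (Real.rpow_pos_of_pos hr α).ne'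
    field_simp
    ring
  have h2 : Tendsto (fun h : ℝ => Real.exp (-v + (h ^ 2 * v) * v / 2) / (1 - h ^ 2 * v))
      (𝓝[>] 0) (𝓝 (Real.exp (-v))) := by
    have : Tendsto (fun r : ℝ => Real.exp (-v + r * v / 2) / (1 - r)) (𝓝 0)
        (𝓝 (Real.exp (-v + 0 * v / 2) / (1 - 0))) :=
      ContinuousAt.tendsto (f := fun r : ℝ => Real.exp (-v + r * v / 2) / (1 - r))
        (ContinuousAt.div (by fun_prop) (by fun_prop) (by norm_num))
    simp only [zero_mul, zero_div, add_zero, sub_zero, div_one] at this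
    exact this.comp hsq
  have h3 := ((h1.comp hsq').mul_const (v ^ α)).mul h2
  rw [mul_assoc] at h3
  refine h3.congr' ?_
  filter_upwards [self_mem_nhdsWithin, hsq.eventually (gt_mem_nhds hε)] with h hh hlt
  have hh : 0 < h := hh
  rw [rescaled, indicator_of_mem]
  · simp only [Function.comp_apply]
    rw [Real.mul_rpow (by positivity) hv.le, Real.rpow_neg hh.le, Real.rpow_mul hh.le,
      Real.rpow_two]
    have : v ^ α ≠ 0 := (Real.rpow_pos_of_pos hv α).ne'
    have : (h ^ 2) ^ α ≠ 0 := (Real.rpow_pos_of_pos (by positivity) α).ne'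
    have e : h ^ 2 * v * v / 2 = h ^ 2 * v ^ 2 / 2 := by ring
    rw [e]
    field_simp
  · exact ⟨hv, by rwa [lt_div_iff₀ (by positivity), mul_comm]⟩

/-- The `L¹` distance between the rescaled kernel and its limit. -/
noncomputable def laplaceError (φ : ℝ → ℝ) (A α ε h : ℝ) : ℝ :=
  ∫ v in Ioi (0 : ℝ), |rescaled φ α ε h v - A * (v ^ α * Real.exp (-v))|

section

variable {φ : ℝ → ℝ} {A α ε C : ℝ}

theorem integrableOn_gamma_weight (hα : 0 ≤ α) :
    IntegrableOn (fun v : ℝ => v ^ α * Real.exp (-v)) (Ioi 0) := by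
  simpa using integrableOn_rpow_mul_exp_neg_mul hα one_pos

theorem integrableOn_rescaled (hφ : Integrable φ) (hα : 0 ≤ α) (hε : ε ≤ 1 / 2)
    (hC : ∀ r ∈ Ioo 0 ε, |φ (1 - r)| ≤ C * r ^ α) (hC0 : 0 ≤ C) {h : ℝ} (hh : 0 < h) :
    IntegrableOn (rescaled φ α ε h) (Ioi 0) := by
  refine Integrable.mono' ((integrableOn_rpow_mul_exp_neg_mul hα one_half_pos).const_mul (2 * C))
    (aestronglyMeasurable_rescaled hφ α ε hh).restrict ?_
  filter_upwards [ae_restrict_mem measurableSet_Ioi] with v hv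
  exact norm_rescaled_le hε hC hC0 hh hv

theorem tendsto_laplaceError (hφ : Integrable φ) (hα : 0 ≤ α) (hε0 : 0 < ε) (hε : ε ≤ 1 / 2)
    (hC : ∀ r ∈ Ioo 0 ε, |φ (1 - r)| ≤ C * r ^ α) (hC0 : 0 ≤ C)
    (hexp : (fun t : ℝ => φ (1 - t) - A * t ^ α) =o[𝓝[>] 0] fun t : ℝ => t ^ α) :
    Tendsto (laplaceError φ A α ε) (𝓝[>] 0) (𝓝 0) := by
  have key : Tendsto (laplaceError φ A α ε) (𝓝[>] 0)
      (𝓝 (∫ _ in Ioi (0 : ℝ), (0 : ℝ))) := by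
    refine tendsto_integral_filter_of_dominated_convergence
      (fun v => 2 * C * (v ^ α * Real.exp (-(1 / 2) * v)) + |A| * (v ^ α * Real.exp (-v)))
      ?_ ?_ (((integrableOn_rpow_mul_exp_neg_mul hα one_half_pos).const_mul (2 * C)).add
        ((integrableOn_gamma_weight hα).const_mul |A|)) ?_
    · filter_upwards [self_mem_nhdsWithin] with h hh
      exact ((aestronglyMeasurable_rescaled hφ α ε hh).restrict.sub
        ((integrableOn_gamma_weight hα).const_mul A).aestronglyMeasurable).norm
    · filter_upwards [self_mem_nhdsWithin] with h hh
      filter_upwards [ae_restrict_mem measurableSet_Ioi] with v hv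
      have hv : 0 < v := hv
      rw [Real.norm_eq_abs, abs_abs]
      refine (abs_sub _ _).trans (add_le_add (norm_rescaled_le hε hC hC0 hh hv) ?_)
      rw [abs_mul, abs_of_pos (by positivity : 0 < v ^ α * Real.exp (-v))]
    · filter_upwards [ae_restrict_mem measurableSet_Ioi] with v hv
      have := ((tendsto_rescaled hε0 hexp hv).sub_const (A * (v ^ α * Real.exp (-v)))).abs
      simpa using this
  simpa using key

theorem setIntegral_near_one (φ : ℝ → ℝ) (α ε : ℝ) {h : ℝ} (hh : 0 < h) (y : ℝ) :
    ∫ s in Ioo (1 - ε) 1, φ s * Real.exp (s ^ 2 / (2 * h ^ 2)) * (Real.sin (s * y) / s) =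
      rate α h * ∫ v in Ioi (0 : ℝ), rescaled φ α ε h v * Real.sin ((1 - h ^ 2 * v) * y) := by
  set F : ℝ → ℝ := fun s => φ s * Real.exp (s ^ 2 / (2 * h ^ 2)) * (Real.sin (s * y) / s)
  have h2 : 0 < h ^ 2 := by positivity
  rw [← integral_indicator measurableSet_Ioo,
    ← integral_sub_left_eq_self ((Ioo (1 - ε) 1).indicator F) volume 1]
  have h3 := Measure.integral_comp_mul_left
    (fun s => (Ioo (1 - ε) 1).indicator F (1 - s)) (h ^ 2)
  rw [abs_of_pos (inv_pos.mpr h2), smul_eq_mul, ← inv_mul_eq_iff_eq_mul₀ (inv_ne_zero h2.ne'),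
    inv_inv] at h3
  rw [← h3, setIntegral_eq_integral_of_forall_compl_eq_zero, ← integral_const_mul,
    ← integral_const_mul]
  · refine integral_congr_ae (Eventually.of_forall fun v => ?_)
    have hmem : 1 - h ^ 2 * v ∈ Ioo (1 - ε) 1 ↔ v ∈ Ioo 0 (ε / h ^ 2) := by
      rw [mem_Ioo, mem_Ioo, lt_div_iff₀ h2, mul_comm v]
      constructor
      · rintro ⟨h4, h5⟩
        exact ⟨pos_of_mul_pos_right (by linarith : 0 < h ^ 2 * v) h2.le, by linarith⟩
      · rintro ⟨h4, h5⟩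
        have := mul_pos h2 h4
        constructor <;> linarith
    by_cases hv : v ∈ Ioo 0 (ε / h ^ 2)
    · simp only [rescaled, indicator_of_mem hv, indicator_of_mem (hmem.mpr hv), F, rate]
      have e1 : (1 - h ^ 2 * v) ^ 2 / (2 * h ^ 2) =
          1 / (2 * h ^ 2) + (-v + h ^ 2 * v ^ 2 / 2) := by
        field_simp
        ring
      rw [e1, Real.exp_add, Real.rpow_add hh, Real.rpow_neg hh.le, Real.rpow_two]
      have : h ^ (2 * α) ≠ 0 := (Real.rpow_pos_of_pos hh _).ne'
      field_simp
    · simp only [rescaled, indicator_of_notMem hv, indicator_of_notMem (mt hmem.mp hv)]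
      simp
  · intro v hv
    rw [rescaled, indicator_of_notMem fun hc => hv hc.1, zero_mul]

/-- Since the sine is bounded by one, the `L¹` distance of the weights controls the error for all
`y` at once. -/
theorem abs_setIntegral_near_one_sub_le (hφ : Integrable φ) (hα : 0 ≤ α) (hε : ε ≤ 1 / 2)
    (hC : ∀ r ∈ Ioo 0 ε, |φ (1 - r)| ≤ C * r ^ α) (hC0 : 0 ≤ C) (A : ℝ) {h : ℝ} (hh : 0 < h)
    (y : ℝ) :
    |(∫ s in Ioo (1 - ε) 1, φ s * Real.exp (s ^ 2 / (2 * h ^ 2)) * (Real.sin (s * y) / s)) /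
      rate α h - A * gammaSine α h y| ≤ laplaceError φ A α ε h := by
  have hs : AEStronglyMeasurable (fun v : ℝ => Real.sin ((1 - h ^ 2 * v) * y))
    (volume.restrict (Ioi 0)) := Continuous.aestronglyMeasurable (by fun_prop)
  have hs1 : ∀ᵐ v ∂(volume.restrict (Ioi (0 : ℝ))), ‖Real.sin ((1 - h ^ 2 * v) * y)‖ ≤ 1 :=
    Eventually.of_forall fun v => Real.abs_sin_le_one _
  have hi1 := integrableOn_rescaled hφ hα hε hC hC0 hh
  have hi2 := integrableOn_gamma_weight hα
  rw [setIntegral_near_one φ α ε hh, mul_div_cancel_left₀ _ (rate_pos α hh).ne', gammaSine,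
    ← integral_const_mul, ← integral_sub (hi1.mul_bdd hs hs1) ((hi2.mul_bdd hs hs1).const_mul A)]
  refine norm_integral_le_of_norm_le (f := fun v => rescaled φ α ε h v *
    Real.sin ((1 - h ^ 2 * v) * y) - A * (v ^ α * Real.exp (-v) *
      Real.sin ((1 - h ^ 2 * v) * y))) (hi1.sub (hi2.const_mul A)).norm
    (Eventually.of_forall fun v => ?_)
  rw [← mul_assoc, ← sub_mul, norm_mul]
  exact mul_le_of_le_one_right (norm_nonneg _) (Real.abs_sin_le_one _)

/-- The range is cut at `η`: below it `|sin (s y) / s| ≤ |y|` comes with the small weight `exp (η² /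
(2h²))`; above it `1 / s ≤ 1 / η` makes the bound independent of `y`. -/
theorem abs_setIntegral_away_from_one_le (hφ : Integrable φ) {η : ℝ}
    (hη0 : 0 < η) {h : ℝ} (y : ℝ) :
    |∫ s in Ioc 0 (1 - ε), φ s * Real.exp (s ^ 2 / (2 * h ^ 2)) * (Real.sin (s * y) / s)| ≤
      (∫ s, |φ s|) * (Real.exp (η ^ 2 / (2 * h ^ 2)) * |y| +
        Real.exp ((1 - ε) ^ 2 / (2 * h ^ 2)) / η) := by
  set B : ℝ := Real.exp (η ^ 2 / (2 * h ^ 2)) * |y| + Real.exp ((1 - ε) ^ 2 / (2 * h ^ 2)) / η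
  have hB : 0 ≤ B := by positivity
  have h1 : |∫ s in Ioc 0 (1 - ε), φ s * Real.exp (s ^ 2 / (2 * h ^ 2)) *
      (Real.sin (s * y) / s)| ≤ ∫ s in Ioc 0 (1 - ε), |φ s| * B := by
    rw [← Real.norm_eq_abs]
    refine norm_integral_le_of_norm_le (hφ.abs.mul_const B).integrableOn ?_
    filter_upwards [ae_restrict_mem measurableSet_Ioc] with s hs
    rw [mul_assoc, norm_mul, Real.norm_eq_abs]
    gcongr
    rw [norm_mul, Real.norm_eq_abs, Real.abs_exp]
    rcases le_or_gt s η with hsη | hsη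
    · have : Real.exp (s ^ 2 / (2 * h ^ 2)) * ‖Real.sin (s * y) / s‖ ≤
          Real.exp (η ^ 2 / (2 * h ^ 2)) * |y| := by
        gcongr
        · exact hs.1.le
        · exact abs_sin_mul_div_le s y
      exact this.trans (le_add_of_nonneg_right (by positivity))
    · have : Real.exp (s ^ 2 / (2 * h ^ 2)) * ‖Real.sin (s * y) / s‖ ≤
          Real.exp ((1 - ε) ^ 2 / (2 * h ^ 2)) * (1 / η) := by
        gcongr
        · exact hs.1.le
        · exact hs.2
        · rw [norm_div, Real.norm_eq_abs, Real.norm_eq_abs, abs_of_pos hs.1]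
          gcongr
          exact Real.abs_sin_le_one _
      rw [mul_one_div] at this
      exact this.trans (le_add_of_nonneg_left (by positivity))
  refine h1.trans ?_
  rw [integral_mul_const]
  gcongr ?_ * B
  exact setIntegral_le_integral hφ.abs (Eventually.of_forall fun s => abs_nonneg _)

theorem exists_bound_near_one
    (hexp : (fun t : ℝ => φ (1 - t) - A * t ^ α) =o[𝓝[>] 0] fun t : ℝ => t ^ α) :
    ∃ ε, 0 < ε ∧ ε ≤ 1 / 2 ∧ ∀ r ∈ Ioo 0 ε, |φ (1 - r)| ≤ (|A| + 1) * r ^ α := by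
  have h1 := hexp.bound one_pos
  rw [eventually_nhdsWithin_iff, Metric.eventually_nhds_iff] at h1
  obtain ⟨ε, hε, h1⟩ := h1
  refine ⟨min ε (1 / 2), by positivity, min_le_right _ _, fun r hr => ?_⟩
  have hr0 : 0 < r := hr.1
  have h2 := h1 (y := r) (by
    rw [Real.dist_eq, sub_zero, abs_of_pos hr0]; exact hr.2.trans_le (min_le_left _ _)) hr0
  have h3 : 0 < r ^ α := Real.rpow_pos_of_pos hr0 α
  rw [one_mul, Real.norm_eq_abs, Real.norm_eq_abs, abs_of_pos h3] at h2
  have h4 := abs_sub_abs_le_abs_sub (φ (1 - r)) (A * r ^ α)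
  rw [abs_mul, abs_of_pos h3] at h4
  linarith

/-- Uniform Laplace asymptotics of the sine transform of the kernel. -/
theorem exists_sineTransform_bound (hφ : Integrable φ) (hα : 0 ≤ α)
    (hexp : (fun t : ℝ => φ (1 - t) - A * t ^ α) =o[𝓝[>] 0] fun t : ℝ => t ^ α)
    {η : ℝ} (hη : 0 < η) :
    ∃ ρ : ℝ → ℝ, ∃ M : ℝ, 0 ≤ M ∧ Tendsto ρ (𝓝[>] 0) (𝓝 0) ∧ ∀ h, 0 < h → ∀ y,
      |sineTransform φ h y / rate α h - A * gammaSine α h y| ≤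
        ρ h + M * (Real.exp (η ^ 2 / (2 * h ^ 2)) / rate α h) * |y| := by
  obtain ⟨ε, hε0, hε, hC⟩ := exists_bound_near_one hexp
  have hC0 : 0 ≤ |A| + 1 := by positivity
  set M := ∫ s, |φ s|
  have hM : 0 ≤ M := integral_nonneg fun s => abs_nonneg _
  -- `ρ` collects the contributions that are uniform in `y`. Only the range `s ≤ η` produces the
  -- term growing with `|y|`.
  refine ⟨fun h => laplaceError φ A α ε h +
    M / η * (Real.exp ((1 - ε) ^ 2 / (2 * h ^ 2)) / rate α h), M, hM, ?_, fun h hh y => ?_⟩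
  · have h1 := tendsto_laplaceError hφ hα hε0 hε hC hC0 hexp
    have h2 := (tendsto_rpow_mul_exp_neg_div_sq (2 + 2 * α)
      (by nlinarith : 0 < (1 - (1 - ε) ^ 2) / 2)).const_mul (M / η)
    have h3 := h1.add h2
    rw [mul_zero, add_zero] at h3
    refine h3.congr' ?_
    filter_upwards [self_mem_nhdsWithin] with h hh
    rw [exp_div_rate_eq _ _ hh]
  · have hN := rate_pos α hh
    have hsplit : sineTransform φ h y =
        (∫ s in Ioc 0 (1 - ε), φ s * Real.exp (s ^ 2 / (2 * h ^ 2)) * (Real.sin (s * y) / s)) +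
        ∫ s in Ioo (1 - ε) 1, φ s * Real.exp (s ^ 2 / (2 * h ^ 2)) * (Real.sin (s * y) / s) := by
      have hU : Ioo (0 : ℝ) 1 = Ioc 0 (1 - ε) ∪ Ioo (1 - ε) 1 :=
        (Ioc_union_Ioo_eq_Ioo (by linarith) (by linarith)).symm
      have hi := integrableOn_sineTransform hφ h y
      rw [sineTransform, hU]
      rw [hU] at hi
      refine setIntegral_union ?_ measurableSet_Ioo (hi.mono_set subset_union_left)
        (hi.mono_set subset_union_right)
      exact disjoint_left.mpr fun s h1 h2 => absurd h1.2 (not_le.mpr h2.1)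
    have h1 := abs_setIntegral_near_one_sub_le hφ hα hε hC hC0 A hh y
    have h2 := abs_setIntegral_away_from_one_le hφ (ε := ε) hη (h := h) y
    have h3 := div_le_div_of_nonneg_right h2 hN.le
    rw [← abs_of_pos hN, ← abs_div, abs_of_pos hN] at h3
    rw [hsplit, add_div, add_sub_assoc]
    refine (abs_add_le _ _).trans ((add_le_add h3 h1).trans (le_of_eq ?_))
    ring

end

/-! ### The limiting Gamma integral at low and high frequency. -/

theorem integral_rpow_mul_exp_neg {α : ℝ} (hα : 0 ≤ α) :
    ∫ v in Ioi (0 : ℝ), v ^ α * Real.exp (-v) = Real.Gamma (α + 1) := by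
  rw [Real.Gamma_eq_integral (by linarith)]
  simp only [add_sub_cancel_right, mul_comm]

/-- The modulus of the Fourier transform of the Gamma density weight. -/
noncomputable def gammaFourierNorm (α z : ℝ) : ℝ :=
  ‖∫ v in Ioi (0 : ℝ), ((v ^ α * Real.exp (-v) : ℝ) : ℂ) *
    Complex.exp (((-(v * z) : ℝ) : ℂ) * Complex.I)‖

/-- This is the Riemann-Lebesgue lemma; the rescaling by `2 * π` matches the normalisation of the
Fourier character. -/
theorem tendsto_gammaFourierNorm (α : ℝ) :
    Tendsto (gammaFourierNorm α) atTop (𝓝 0) := by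
  have h1 := (Real.tendsto_integral_exp_smul_cocompact
    ((Ioi (0 : ℝ)).indicator fun v => ((v ^ α * Real.exp (-v) : ℝ) : ℂ))).norm
  rw [norm_zero] at h1
  have h2 : Tendsto (fun z : ℝ => z / (2 * Real.pi)) atTop (cocompact ℝ) :=
    (tendsto_id.atTop_div_const (by positivity)).mono_right atTop_le_cocompact
  refine (h1.comp h2).congr fun z => ?_
  simp only [Function.comp_apply, gammaFourierNorm]
  rw [← integral_indicator measurableSet_Ioi]
  congr 2
  funext v
  by_cases hv : v ∈ Ioi (0 : ℝ)
  · rw [indicator_of_mem hv, indicator_of_mem hv, Circle.smul_def, Real.fourierChar_apply,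
      smul_eq_mul, mul_comm]
    congr 4
    field_simp
  · rw [indicator_of_notMem hv, indicator_of_notMem hv, smul_zero]

/-- The sine is the imaginary part of `e^(iy) e^(-i v h² y)`. The fast phase `e^(iy)` has modulus
one, so only the slow frequency `h² y` matters. -/
theorem abs_gammaSine_le {α : ℝ} (hα : 0 ≤ α) (h y : ℝ) :
    |gammaSine α h y| ≤ gammaFourierNorm α (h ^ 2 * y) := by
  have hint : IntegrableOn (fun v : ℝ => ((v ^ α * Real.exp (-v) : ℝ) : ℂ) *
      Complex.exp (((-(v * (h ^ 2 * y)) : ℝ) : ℂ) * Complex.I)) (Ioi 0) :=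
    (integrableOn_gamma_weight hα).ofReal.mul_bdd (c := 1)
      (Continuous.aestronglyMeasurable (by fun_prop))
      (Eventually.of_forall fun v => (Complex.norm_exp_ofReal_mul_I _).le)
  have h1 : gammaSine α h y = (Complex.exp ((y : ℂ) * Complex.I) *
      ∫ v in Ioi (0 : ℝ), ((v ^ α * Real.exp (-v) : ℝ) : ℂ) *
        Complex.exp (((-(v * (h ^ 2 * y)) : ℝ) : ℂ) * Complex.I)).im := by
    rw [← integral_const_mul, ← RCLike.im_eq_complex_im, ← integral_im (hint.const_mul _)]
    refine setIntegral_congr_fun measurableSet_Ioi fun v _ => ?_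
    simp only [RCLike.im_eq_complex_im]
    rw [mul_left_comm, ← Complex.exp_add, ← add_mul, ← Complex.ofReal_add, Complex.im_ofReal_mul,
      Complex.exp_ofReal_mul_I_im]
    congr 2
    ring
  rw [h1]
  refine (Complex.abs_im_le_norm _).trans (le_of_eq ?_)
  rw [norm_mul, Complex.norm_exp_ofReal_mul_I, one_mul, gammaFourierNorm]

theorem gammaFourierNorm_le {α : ℝ} (hα : 0 ≤ α) (z : ℝ) :
    gammaFourierNorm α z ≤ Real.Gamma (α + 1) := by
  refine (norm_integral_le_integral_norm _).trans (le_of_eq ?_)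
  rw [← integral_rpow_mul_exp_neg hα]
  refine setIntegral_congr_fun measurableSet_Ioi fun v hv => ?_
  have hv : 0 < v := hv
  simp only [norm_mul]
  rw [Complex.norm_exp_ofReal_mul_I, mul_one, Complex.norm_real, Real.norm_eq_abs,
    abs_of_pos (by positivity)]

theorem continuous_gammaFourierNorm {α : ℝ} (hα : 0 ≤ α) : Continuous (gammaFourierNorm α) := by
  refine Continuous.norm (continuous_of_dominated
    (bound := fun v => ‖v ^ α * Real.exp (-v)‖) (fun z => ?_)
    (fun z => Eventually.of_forall fun v => ?_)
    (integrableOn_gamma_weight hα).norm (Eventually.of_forall fun v => by fun_prop))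
  · exact (integrableOn_gamma_weight hα).ofReal.aestronglyMeasurable.mul
      (Continuous.aestronglyMeasurable (by fun_prop))
  · rw [norm_mul, Complex.norm_exp_ofReal_mul_I, mul_one, Complex.norm_real]

/-- The sine is 1-Lipschitz and its argument moves by `h² v y`; the extra factor `v` raises the
Gamma argument by one. -/
theorem abs_gammaSine_sub_le {α : ℝ} (hα : 0 ≤ α) (h y : ℝ) :
    |gammaSine α h y - Real.Gamma (α + 1) * Real.sin y| ≤ h ^ 2 * |y| * Real.Gamma (α + 2) := by
  have hi := integrableOn_gamma_weight hα
  have hi' := integrableOn_gamma_weight (α := α + 1) (by linarith)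
  rw [← integral_rpow_mul_exp_neg hα, gammaSine, ← integral_mul_const, ← integral_sub
    (hi.mul_bdd (c := 1) (Continuous.aestronglyMeasurable (by fun_prop))
      (Eventually.of_forall fun v => Real.abs_sin_le_one _)) (hi.mul_const _),
    show α + 2 = (α + 1) + 1 by ring,
    ← integral_rpow_mul_exp_neg (by linarith : 0 ≤ α + 1), ← integral_const_mul,
    ← Real.norm_eq_abs]
  refine norm_integral_le_of_norm_le (hi'.const_mul _) ?_
  filter_upwards [ae_restrict_mem measurableSet_Ioi] with v hv
  have hv : 0 < v := hv
  have h1 : |Real.sin ((1 - h ^ 2 * v) * y) - Real.sin y| ≤ h ^ 2 * |y| * v := by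
    refine (Real.abs_sin_sub_sin_le _ _).trans (le_of_eq ?_)
    rw [show (1 - h ^ 2 * v) * y - y = -(h ^ 2 * y * v) by ring, abs_neg, abs_mul, abs_mul,
      abs_of_pos hv, abs_of_nonneg (sq_nonneg h)]
  rw [← mul_sub, norm_mul, Real.norm_eq_abs, Real.norm_eq_abs,
    abs_of_pos (by positivity : 0 < v ^ α * Real.exp (-v)), Real.rpow_add_one hv.ne']
  calc _ ≤ v ^ α * Real.exp (-v) * (h ^ 2 * |y| * v) := by gcongr
    _ = _ := by ring

/-! ### Quadratic-mean control of the remainder. -/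

/-- The deviation of a normalised summand from its limiting sinusoid. -/
noncomputable def remainder (φ : ℝ → ℝ) (A α h a b x : ℝ) : ℝ :=
  summand φ h a b x / rate α h + A * Real.Gamma (α + 1) / Real.pi * Real.sin ((x - b) / h)

theorem continuous_remainder {φ : ℝ → ℝ} (hφ : Integrable φ) (A α h a b : ℝ) :
    Continuous (remainder φ A α h a b) := by
  have := continuous_sineTransform hφ h
  unfold remainder summand
  fun_prop

/-- The end point `a` is treated by the Fourier bound and `b` by the Lipschitz bound. Growth of
order `1 + |x|` is affordable because `X` has a second moment. -/
theorem abs_remainder_le {φ : ℝ → ℝ} {A α : ℝ} (hα : 0 ≤ α) {h r τ : ℝ} (hh : 0 < h)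
    (hτ : 0 ≤ τ)
    (hb : ∀ y, |sineTransform φ h y / rate α h - A * gammaSine α h y| ≤ r + τ * |y|)
    (a b x : ℝ) :
    |remainder φ A α h a b x| ≤ (2 * |r| + τ / h * (2 + |a| + |b|) +
      |A| * Real.Gamma (α + 2) * (h * (1 + |b|))) * (1 + |x|) +
      |A| * gammaFourierNorm α (h * (x - a)) := by
  set ya := (x - a) / h
  set yb := (x - b) / h
  have e : remainder φ A α h a b x = (1 / Real.pi) *
      ((sineTransform φ h ya / rate α h - A * gammaSine α h ya) + A * gammaSine α h ya -
        (sineTransform φ h yb / rate α h - A * gammaSine α h yb) -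
        A * (gammaSine α h yb - Real.Gamma (α + 1) * Real.sin yb)) := by
    simp only [remainder, summand, ya, yb]
    ring
  have hpi : |1 / Real.pi| ≤ 1 := by
    rw [abs_of_pos (by positivity), div_le_one Real.pi_pos]
    linarith [Real.pi_gt_three]
  have hΓ : 0 < Real.Gamma (α + 2) := Real.Gamma_pos_of_pos (by linarith)
  have ha1 : |ya| ≤ (|x| + |a|) / h := by
    rw [abs_div, abs_of_pos hh]
    gcongr
    exact abs_sub _ _
  have hb1 : |yb| ≤ (|x| + |b|) / h := by
    rw [abs_div, abs_of_pos hh]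
    gcongr
    exact abs_sub _ _
  have h1 : |sineTransform φ h ya / rate α h - A * gammaSine α h ya| ≤
      |r| + τ * ((|x| + |a|) / h) := (hb ya).trans (by gcongr; exact le_abs_self r)
  have h2 : |sineTransform φ h yb / rate α h - A * gammaSine α h yb| ≤
      |r| + τ * ((|x| + |b|) / h) := (hb yb).trans (by gcongr; exact le_abs_self r)
  have h3 : |A * gammaSine α h ya| ≤ |A| * gammaFourierNorm α (h * (x - a)) := by
    rw [abs_mul]
    gcongr
    have := abs_gammaSine_le hα h ya
    rwa [show h ^ 2 * ya = h * (x - a) by simp only [ya]; field_simp] at this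
  have h4 : |A * (gammaSine α h yb - Real.Gamma (α + 1) * Real.sin yb)| ≤
      |A| * Real.Gamma (α + 2) * (h * (|x| + |b|)) := by
    rw [abs_mul, mul_assoc]
    gcongr
    refine (abs_gammaSine_sub_le hα h yb).trans ?_
    rw [mul_comm]
    refine mul_le_mul_of_nonneg_left ?_ hΓ.le
    calc h ^ 2 * |yb| ≤ h ^ 2 * ((|x| + |b|) / h) := by gcongr
      _ = h * (|x| + |b|) := by field_simp
  have hx := abs_nonneg x
  have ha0 := abs_nonneg a
  have hb0 := abs_nonneg b
  have e1 : |x| + |b| ≤ (1 + |b|) * (1 + |x|) := by nlinarith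
  have e2 : (|x| + |a|) + (|x| + |b|) ≤ (2 + |a| + |b|) * (1 + |x|) := by nlinarith
  have e3 : |r| ≤ |r| * (1 + |x|) := by nlinarith [abs_nonneg r]
  have e4 := mul_le_mul_of_nonneg_left e1 (by positivity : 0 ≤ |A| * Real.Gamma (α + 2) * h)
  have e5 := mul_le_mul_of_nonneg_left e2 (by positivity : 0 ≤ τ / h)
  rw [e, abs_mul]
  refine (mul_le_of_le_one_left (abs_nonneg _) hpi).trans ?_
  refine (abs_sub _ _).trans ?_
  have h5 := (abs_sub (sineTransform φ h ya / rate α h - A * gammaSine α h ya +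
    A * gammaSine α h ya) (sineTransform φ h yb / rate α h - A * gammaSine α h yb)).trans
      (add_le_add_left (abs_add_le _ _) _)
  have e6 : τ * ((|x| + |a|) / h) + τ * ((|x| + |b|) / h) =
      τ / h * ((|x| + |a|) + (|x| + |b|)) := by ring
  linarith

/-- The normalised summands are close to a sinusoid, up to an error that is small in quadratic mean
as soon as the left end point of the interval escapes fast enough. -/
theorem exists_remainder_bound {φ : ℝ → ℝ} {A α : ℝ} (hφ : Integrable φ) (hα : 0 ≤ α)
    (hexp : (fun t : ℝ => φ (1 - t) - A * t ^ α) =o[𝓝[>] 0] fun t : ℝ => t ^ α)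
    {h a : ℕ → ℝ} (b : ℝ) {δ : ℝ} (hh_pos : ∀ n, 0 < h n) (hh_lim : Tendsto h atTop (𝓝 0))
    (hδ_pos : 0 < δ) (hδ_lt : δ < 1)
    (ha_rate : a =o[atTop] fun n => Real.exp (1 / (2 * h n ^ 2) * (1 - δ))) :
    ∃ σ : ℕ → ℝ, Tendsto σ atTop (𝓝 0) ∧ ∀ n x,
      |remainder φ A α (h n) (a n) b x| ≤
        σ n * (1 + |x|) + |A| * gammaFourierNorm α (h n * (x - a n)) := by
  -- The choice `η² = δ / 2` leaves room: with `|a|` of smaller order than `exp ((1 - δ) / (2h²))`,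
  -- a factor `exp (-δ / (4h²))` remains to beat the powers of `h`.
  obtain ⟨ρ, M, hM, hρ, hbd⟩ := exists_sineTransform_bound hφ hα hexp
    (Real.sqrt_pos.mpr (half_pos hδ_pos))
  have hlim : Tendsto h atTop (𝓝[>] 0) :=
    tendsto_nhdsWithin_iff.mpr ⟨hh_lim, Eventually.of_forall hh_pos⟩
  set τ : ℝ → ℝ := fun h => M * (Real.exp (√(δ / 2) ^ 2 / (2 * h ^ 2)) / rate α h)
  have hτ (n : ℕ) : 0 ≤ τ (h n) := by
    have := rate_pos α (hh_pos n)
    positivity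
  have hτeq (n : ℕ) : τ (h n) / h n =
      M * (h n ^ (-(3 + 2 * α)) * Real.exp (-((1 - δ / 2) / 2) / h n ^ 2)) := by
    simp only [τ]
    rw [exp_div_rate_eq _ _ (hh_pos n), Real.sq_sqrt (by positivity),
      show -(3 + 2 * α) = -(2 + 2 * α) - 1 by ring, Real.rpow_sub_one (hh_pos n).ne']
    ring
  have hτ1 : Tendsto (fun n => τ (h n) / h n) atTop (𝓝 0) := by
    simp only [hτeq]
    simpa using ((tendsto_rpow_mul_exp_neg_div_sq (3 + 2 * α)
      (by linarith : 0 < (1 - δ / 2) / 2)).comp hlim).const_mul M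
  have hτ2 : Tendsto (fun n => τ (h n) / h n * |a n|) atTop (𝓝 0) := by
    have h1 := ha_rate.tendsto_div_nhds_zero.abs
    have h2 := ((tendsto_rpow_mul_exp_neg_div_sq (3 + 2 * α)
      (by positivity : 0 < δ / 4)).comp hlim).const_mul M
    have h3 := h2.mul h1
    rw [mul_zero, zero_mul] at h3
    refine h3.congr fun n => ?_
    rw [hτeq, abs_div, Real.abs_exp]
    simp only [Function.comp_apply]
    rw [show -((1 - δ / 2) / 2) / h n ^ 2 =
      -(δ / 4) / h n ^ 2 - 1 / (2 * h n ^ 2) * (1 - δ) by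
        have := (hh_pos n).ne'; field_simp; ring, Real.exp_sub]
    ring
  refine ⟨fun n => 2 * |ρ (h n)| + τ (h n) / h n * (2 + |a n| + |b|) +
    |A| * Real.Gamma (α + 2) * (h n * (1 + |b|)), ?_, fun n x => ?_⟩
  · have h1 := (hρ.comp hlim).abs.const_mul 2
    have h2 := (hτ1.mul_const (2 + |b|)).add hτ2
    have h3 := (hh_lim.mul_const (1 + |b|)).const_mul (|A| * Real.Gamma (α + 2))
    have h4 := (h1.add h2).add h3
    simp only [abs_zero, mul_zero, zero_mul, add_zero] at h4
    refine h4.congr fun n => ?_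
    simp only [Function.comp_apply]
    ring
  · exact abs_remainder_le hα (hh_pos n) (hτ n) (hbd (h n) (hh_pos n)) (a n) b x

/-- For each fixed outcome `h (X - a)` tends to infinity because `a h → -∞`. Dominated convergence
with the constant `Γ(α+1)²` therefore suffices, without uniformity in `x`. -/
theorem tendsto_integral_remainder_sq {Ω : Type*} [MeasurableSpace Ω] {P : Measure Ω}
    [IsProbabilityMeasure P] {X : Ω → ℝ} (hXm : AEMeasurable X P)
    (hX_sq : Integrable (fun ω => X ω ^ 2) P) {φ : ℝ → ℝ} {A α : ℝ} (hφ : Integrable φ)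
    (hα : 0 ≤ α) {h a σ : ℕ → ℝ} {b : ℝ} (hh_lim : Tendsto h atTop (𝓝 0))
    (hah_lim : Tendsto (fun n => a n * h n) atTop atBot)
    (hσ : Tendsto σ atTop (𝓝 0))
    (hbd : ∀ n x, |remainder φ A α (h n) (a n) b x| ≤
        σ n * (1 + |x|) + |A| * gammaFourierNorm α (h n * (x - a n))) :
    (∀ n, MemLp (fun ω => remainder φ A α (h n) (a n) b (X ω)) 2 P) ∧
    Tendsto (fun n => ∫ ω, remainder φ A α (h n) (a n) b (X ω) ^ 2 ∂P) atTop (𝓝 0) := by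
  have hJc := continuous_gammaFourierNorm hα
  have hX2 : MemLp X 2 P := (memLp_two_iff_integrable_sq hXm.aestronglyMeasurable).mpr hX_sq
  have h1X : Integrable (fun ω => (1 + |X ω|) ^ 2) P :=
    ((memLp_const (1 : ℝ)).add hX2.abs).integrable_sq
  have hJm (n : ℕ) : AEStronglyMeasurable
      (fun ω => gammaFourierNorm α (h n * (X ω - a n))) P :=
    (hJc.measurable.comp_aemeasurable (by fun_prop)).aestronglyMeasurable
  have hJ0 (z : ℝ) : 0 ≤ gammaFourierNorm α z := norm_nonneg _
  have hJi (n : ℕ) : Integrable (fun ω => gammaFourierNorm α (h n * (X ω - a n)) ^ 2) P := by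
    refine Integrable.of_bound ((hJm n).pow 2) (Real.Gamma (α + 1) ^ 2)
      (Eventually.of_forall fun ω => ?_)
    rw [norm_pow, Real.norm_eq_abs, abs_of_nonneg (hJ0 _)]
    exact pow_le_pow_left₀ (hJ0 _) (gammaFourierNorm_le hα _) 2
  have hdom (n : ℕ) : Integrable (fun ω => 2 * σ n ^ 2 * (1 + |X ω|) ^ 2 +
      2 * A ^ 2 * gammaFourierNorm α (h n * (X ω - a n)) ^ 2) P :=
    (h1X.const_mul _).add ((hJi n).const_mul _)
  have hle (n : ℕ) (ω : Ω) : remainder φ A α (h n) (a n) b (X ω) ^ 2 ≤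
      2 * σ n ^ 2 * (1 + |X ω|) ^ 2 +
        2 * A ^ 2 * gammaFourierNorm α (h n * (X ω - a n)) ^ 2 := by
    rw [← sq_abs, ← sq_abs A]
    refine (pow_le_pow_left₀ (abs_nonneg _) (hbd n (X ω)) 2).trans ?_
    refine add_sq_le.trans (le_of_eq ?_)
    ring
  have hRm (n : ℕ) : AEStronglyMeasurable (fun ω => remainder φ A α (h n) (a n) b (X ω)) P :=
    ((continuous_remainder hφ A α (h n) (a n) b).measurable.comp_aemeasurable
      hXm).aestronglyMeasurable
  have hRi (n : ℕ) : Integrable (fun ω => remainder φ A α (h n) (a n) b (X ω) ^ 2) P := by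
    refine (hdom n).mono' ((hRm n).pow 2) (Eventually.of_forall fun ω => ?_)
    rw [Real.norm_eq_abs, abs_of_nonneg (sq_nonneg _)]
    exact hle n ω
  refine ⟨fun n => (memLp_two_iff_integrable_sq (hRm n)).mpr (hRi n), ?_⟩
  have hJlim : Tendsto (fun n => ∫ ω, gammaFourierNorm α (h n * (X ω - a n)) ^ 2 ∂P) atTop
      (𝓝 (∫ _, (0 : ℝ) ∂P)) := by
    refine tendsto_integral_of_dominated_convergence (fun _ => Real.Gamma (α + 1) ^ 2)
      (fun n => (hJm n).pow 2) (integrable_const _)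
      (fun n => Eventually.of_forall fun ω => ?_) (Eventually.of_forall fun ω => ?_)
    · rw [norm_pow, Real.norm_eq_abs, abs_of_nonneg (hJ0 _)]
      exact pow_le_pow_left₀ (hJ0 _) (gammaFourierNorm_le hα _) 2
    · have h1 : Tendsto (fun n => h n * (X ω - a n)) atTop atTop := by
        have h2 := (hh_lim.mul_const (X ω)).add_atTop (tendsto_neg_atBot_atTop.comp hah_lim)
        refine h2.congr fun n => ?_
        simp only [Function.comp_apply]
        ring
      simpa using ((tendsto_gammaFourierNorm α).comp h1).pow 2
  rw [integral_zero] at hJlim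
  have hup : Tendsto (fun n => 2 * σ n ^ 2 * ∫ ω, (1 + |X ω|) ^ 2 ∂P +
      2 * A ^ 2 * ∫ ω, gammaFourierNorm α (h n * (X ω - a n)) ^ 2 ∂P) atTop (𝓝 0) := by
    simpa using ((((hσ.pow 2).const_mul 2).mul_const (∫ ω, (1 + |X ω|) ^ 2 ∂P))).add
      (hJlim.const_mul (2 * A ^ 2))
  refine squeeze_zero (fun n => integral_nonneg fun ω => sq_nonneg _) (fun n => ?_) hup
  rw [← integral_const_mul, ← integral_const_mul,
    ← integral_add (h1X.const_mul _) ((hJi n).const_mul _)]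
  exact integral_mono (hRi n) (hdom n) (hle n)

/-! ### A central limit theorem for bounded row-wise functions. -/

section

variable {Ω : Type*} [MeasurableSpace Ω] {P : Measure Ω} [IsProbabilityMeasure P]

/-- Second order expansion of the characteristic function of a bounded centred variable. -/
theorem norm_charFun_sub_le {ξ : Ω → ℝ} (hξ : AEMeasurable ξ P) {K : ℝ} (hK : ∀ ω, |ξ ω| ≤ K)
    (h0 : P[ξ] = 0) {s : ℝ} (hs : |s| * K ≤ 1) :
    ‖charFun (P.map ξ) s - (1 - (s ^ 2 * P[ξ ^ 2] / 2 : ℝ))‖ ≤ (|s| * K) ^ 3 := by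
  have hi : Integrable ξ P := .of_bound hξ.aestronglyMeasurable K (Eventually.of_forall hK)
  have hi2 : Integrable (fun ω => ξ ω ^ 2) P :=
    .of_bound (hξ.pow_const 2).aestronglyMeasurable (K ^ 2) (Eventually.of_forall fun ω => by
      rw [norm_pow]; exact pow_le_pow_left₀ (norm_nonneg _) (hK ω) 2)
  have hie : Integrable (fun ω => Complex.exp (s * ξ ω * Complex.I)) P := by
    refine .of_bound (Measurable.comp_aemeasurable (g := fun x : ℝ =>
      Complex.exp (s * x * Complex.I)) (by fun_prop) hξ).aestronglyMeasurable 1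
      (Eventually.of_forall fun ω => ?_)
    rw [← Complex.ofReal_mul, Complex.norm_exp_ofReal_mul_I]
  have e1 : ∫ ω, ((1 : ℂ) + (s * Complex.I) * (ξ ω : ℂ) -
      (s ^ 2 / 2 : ℂ) * ((ξ ω ^ 2 : ℝ) : ℂ)) ∂P = 1 - (s ^ 2 * P[ξ ^ 2] / 2 : ℝ) := by
    rw [integral_sub ((integrable_const _).add (hi.ofReal.const_mul _))
      (hi2.ofReal.const_mul _), integral_add (integrable_const _) (hi.ofReal.const_mul _),
      integral_const_mul, integral_const_mul, integral_complex_ofReal, integral_complex_ofReal, h0]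
    simp only [Pi.pow_apply]
    push_cast
    simp
    ring
  have hi3 : Integrable (fun ω => (1 : ℂ) + (s * Complex.I) * (ξ ω : ℂ) -
      (s ^ 2 / 2 : ℂ) * ((ξ ω ^ 2 : ℝ) : ℂ)) P :=
    ((integrable_const _).add (hi.ofReal.const_mul _)).sub (hi2.ofReal.const_mul _)
  rw [charFun_apply_real, integral_map hξ (by fun_prop), ← e1, ← integral_sub hie hi3]
  refine (norm_integral_le_of_norm_le_const (C := (|s| * K) ^ 3)
    (Eventually.of_forall fun ω => ?_)).trans (by simp)
  have h2 : ‖(s * ξ ω * Complex.I : ℂ)‖ ≤ |s| * K := by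
    rw [norm_mul, norm_mul, Complex.norm_I, mul_one, Complex.norm_real, Complex.norm_real]
    exact mul_le_mul_of_nonneg_left (hK ω) (abs_nonneg s)
  -- The third-order Taylor remainder has constant `2 / 9`, later weakened to one.
  have h3 := Complex.exp_bound (h2.trans hs) (n := 3) (by norm_num)
  simp only [Finset.sum_range_succ, Finset.range_zero, Finset.sum_empty] at h3
  norm_num [Nat.factorial] at h3
  have e2 : Complex.exp (s * ξ ω * Complex.I) - ((1 : ℂ) + (s * Complex.I) * (ξ ω : ℂ) -
      (s ^ 2 / 2 : ℂ) * ((ξ ω ^ 2 : ℝ) : ℂ)) = Complex.exp (s * ξ ω * Complex.I) -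
      (1 + s * ξ ω * Complex.I + (s * ξ ω * Complex.I) ^ 2 / 2) := by
    push_cast
    rw [mul_pow _ Complex.I, Complex.I_sq]
    ring
  rw [e2]
  refine h3.trans ?_
  have h4 : ‖(s * ξ ω * Complex.I : ℂ)‖ ^ 3 ≤ (|s| * K) ^ 3 :=
    pow_le_pow_left₀ (norm_nonneg _) h2 3
  simp only [norm_mul, Complex.norm_I, mul_one, Complex.norm_real, Real.norm_eq_abs] at h4
  have h5 : 0 ≤ (|s| * |ξ ω|) ^ 3 := by positivity
  linarith

/-- Central limit theorem for row-wise functions of an i.i.d. sequence that are uniformly bounded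
and whose variances converge. -/
theorem tendstoInDistribution_inv_sqrt_mul_sum_of_bounded {X : ℕ → Ω → ℝ} (hindep : iIndepFun X P)
    (hident : ∀ i, IdentDistrib (X i) (X 0) P P) {f : ℕ → ℝ → ℝ} (hf : ∀ n, Measurable (f n))
    {C : ℝ} (hC : ∀ n x, |f n x| ≤ C) {v : NNReal}
    (hv : Tendsto (fun n => Var[fun ω => f n (X 0 ω); P]) atTop (𝓝 v)) :
    TendstoInDistribution (fun (n : ℕ) ω =>
      (√(n : ℝ))⁻¹ * ∑ j ∈ Finset.range n, (f n (X j ω) - ∫ ω', f n (X 0 ω') ∂P))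
      atTop id (fun _ => P) (gaussianReal 0 v) := by
  have hXm (i : ℕ) : AEMeasurable (X i) P := (hident i).aemeasurable_fst
  set m : ℕ → ℝ := fun n => ∫ ω', f n (X 0 ω') ∂P
  have hfX (n i : ℕ) : AEMeasurable (fun ω => f n (X i ω)) P := (hf n).comp_aemeasurable (hXm i)
  have hfi (n : ℕ) : Integrable (fun ω => f n (X 0 ω)) P :=
    .of_bound (hfX n 0).aestronglyMeasurable C (Eventually.of_forall fun ω => hC n _)
  have hgm (n : ℕ) : Measurable fun x => f n x - m n := (hf n).sub_const _
  have hm (n : ℕ) : |m n| ≤ C := by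
    refine (norm_integral_le_of_norm_le_const (μ := P) (f := fun ω => f n (X 0 ω)) (C := C)
      (Eventually.of_forall fun ω => hC n (X 0 ω))).trans (by simp)
  refine ⟨fun n => ?_, aemeasurable_id, ?_⟩
  · exact (Finset.aemeasurable_fun_sum _ fun j _ => (hfX n j).sub_const _).const_mul _
  refine ProbabilityMeasure.tendsto_iff_tendsto_charFun.2 fun t => ?_
  have hchar (n : ℕ) : charFun (P.map fun ω =>
      (√(n : ℝ))⁻¹ * ∑ j ∈ Finset.range n, (f n (X j ω) - m n)) t =
      charFun (P.map fun ω => f n (X 0 ω) - m n) ((√n)⁻¹ * t) ^ n :=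
    charFun_inv_sqrt_mul_sum (hindep.comp (fun _ x => f n x - m n) fun _ => hgm n)
      fun i => (hident i).comp (hgm n)
  simp only [ProbabilityMeasure.coe_mk, Measure.map_id, charFun_gaussianReal]
  refine Tendsto.congr (fun n => (hchar n).symm) ?_
  have hlim : Complex.exp (t * ((0 : ℝ) : ℂ) * Complex.I - (v : ℂ) * t ^ 2 / 2) =
      Complex.exp (-((v : ℝ) * t ^ 2 / 2 : ℝ)) := by
    congr 1
    push_cast
    simp
  rw [hlim]
  apply Complex.tendsto_pow_exp_of_isLittleO_sub_add_div
  have hs0 : Tendsto (fun n : ℕ => (√(n : ℝ))⁻¹) atTop (𝓝 0) :=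
    tendsto_inv_atTop_zero.comp (Real.tendsto_sqrt_atTop.comp tendsto_natCast_atTop_atTop)
  -- This is `n` times the error in `1 - v t² / (2n)`: the cubic Taylor term, of order `n^(-3/2)`,
  -- and the discrepancy of the variances. Centring doubles the bound `C`.
  have herr : Tendsto (fun n : ℕ => (|t| * (2 * C)) ^ 3 * (√(n : ℝ))⁻¹ +
      t ^ 2 / 2 * |v - Var[fun ω => f n (X 0 ω); P]|) atTop (𝓝 0) := by
    have h1 := (hv.const_sub (v : ℝ)).abs
    simpa using (hs0.const_mul ((|t| * (2 * C)) ^ 3)).add (h1.const_mul (t ^ 2 / 2))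
  have hsmall : ∀ᶠ n : ℕ in atTop, |(√(n : ℝ))⁻¹ * t| * (2 * C) < 1 := by
    have : Tendsto (fun n : ℕ => |(√(n : ℝ))⁻¹ * t| * (2 * C)) atTop (𝓝 0) := by
      simpa using (hs0.mul_const t).abs.mul_const (2 * C)
    exact this.eventually (gt_mem_nhds one_pos)
  rw [isLittleO_iff]
  intro c hc
  filter_upwards [herr.eventually (gt_mem_nhds hc), hsmall, eventually_gt_atTop 0]
    with n hn1 hn2 hn3
  have hn : (0 : ℝ) < n := Nat.cast_pos.mpr hn3
  have hsq : (√(n : ℝ))⁻¹ ^ 2 = 1 / n := by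
    rw [inv_pow, Real.sq_sqrt hn.le, one_div]
  have hvar : ∫ ω, ((fun ω => f n (X 0 ω) - m n) ^ 2) ω ∂P = Var[fun ω => f n (X 0 ω); P] := by
    rw [variance_eq_integral (hfX n 0)]
    rfl
  have hb := norm_charFun_sub_le (P := P) (ξ := fun ω => f n (X 0 ω) - m n)
    ((hfX n 0).sub_const _) (K := 2 * C)
    (fun ω => (abs_sub _ _).trans (by linarith [hC n (X 0 ω), hm n]))
    (by rw [integral_sub (hfi n) (integrable_const _)]; simp [m]) hn2.le
  rw [hvar] at hb
  set V := Var[fun ω => f n (X 0 ω); P]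
  have e1 : (1 - (((√(n : ℝ))⁻¹ * t) ^ 2 * V / 2 : ℝ) : ℂ) -
      (1 + (-((v : ℝ) * t ^ 2 / 2 : ℝ) : ℂ) / n) = ((t ^ 2 / 2 * (v - V) * (1 / n) : ℝ) : ℂ) := by
    rw [mul_pow, hsq]
    push_cast
    ring
  have e2 : ‖(1 / n : ℂ)‖ = 1 / (n : ℝ) := by simp
  rw [e2]
  have h3 : (|(√(n : ℝ))⁻¹ * t| * (2 * C)) ^ 3 = (|t| * (2 * C)) ^ 3 * (√(n : ℝ))⁻¹ * (1 / n) := by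
    rw [← hsq, abs_mul, abs_of_nonneg (by positivity : 0 ≤ (√(n : ℝ))⁻¹)]
    ring
  have h4 : ‖((t ^ 2 / 2 * (v - V) * (1 / n) : ℝ) : ℂ)‖ = t ^ 2 / 2 * |v - V| * (1 / n) := by
    rw [Complex.norm_real, Real.norm_eq_abs, abs_mul, abs_mul, abs_of_nonneg (by positivity),
      abs_of_nonneg (by positivity : (0 : ℝ) ≤ 1 / n)]
  calc _ ≤ _ := norm_sub_le_norm_sub_add_norm_sub _ (1 - (((√(n : ℝ))⁻¹ * t) ^ 2 * V / 2 : ℝ) : ℂ) _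
    _ ≤ (|t| * (2 * C)) ^ 3 * (√(n : ℝ))⁻¹ * (1 / n) + t ^ 2 / 2 * |v - V| * (1 / n) := by
        rw [e1, h4, ← h3]
        exact add_le_add_left hb _
    _ = ((|t| * (2 * C)) ^ 3 * (√(n : ℝ))⁻¹ + t ^ 2 / 2 * |v - V|) * (1 / n) := by ring
    _ ≤ c * (1 / n) := by gcongr

/-! ### Decay of the characteristic function and variance of sinusoids. -/

theorem norm_charFun_add_gaussian_le {Y Z : Ω → ℝ} (hY : Measurable Y) (hZ : Measurable Z)
    (hZ_normal : HasLaw Z (gaussianReal 0 1) P) (hYZ : IndepFun Y Z P) (t : ℝ) :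
    ‖charFun (P.map (fun ω => Y ω + Z ω)) t‖ ≤ Real.exp (-(t ^ 2 / 2)) := by
  have : IsProbabilityMeasure (P.map Y) := Measure.isProbabilityMeasure_map hY.aemeasurable
  have h1 := congrFun (hYZ.charFun_map_fun_add_eq_mul hY.aemeasurable hZ.aemeasurable) t
  rw [h1, Pi.mul_apply, norm_mul, hZ_normal.map_eq, charFun_gaussianReal, Complex.norm_exp]
  refine (mul_le_of_le_one_left (Real.exp_pos _).le (norm_charFun_le_one _)).trans (le_of_eq ?_)
  congr 1
  simp [← Complex.ofReal_pow]

theorem integral_exp_sub_div {μ : Measure Ω} {X : Ω → ℝ} (hX : AEMeasurable X μ) (b s : ℝ) :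
    ∫ ω, Complex.exp (((s * (X ω - b) : ℝ) : ℂ) * Complex.I) ∂μ =
      Complex.exp (((-(s * b) : ℝ) : ℂ) * Complex.I) * charFun (μ.map X) s := by
  rw [charFun_apply_real, integral_map hX (by fun_prop), ← integral_const_mul]
  refine integral_congr_ae (Eventually.of_forall fun ω => ?_)
  simp only [← Complex.exp_add]
  congr 1
  push_cast
  ring

theorem integrable_exp_mul_sub {X : Ω → ℝ} (hX : AEMeasurable X P) (b s : ℝ) :
    Integrable (fun ω => Complex.exp (((s * (X ω - b) : ℝ) : ℂ) * Complex.I)) P :=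
  .of_bound (Measurable.comp_aemeasurable (g := fun x : ℝ =>
      Complex.exp (((s * (x - b) : ℝ) : ℂ) * Complex.I)) (by fun_prop) hX).aestronglyMeasurable 1
      (Eventually.of_forall fun ω => (Complex.norm_exp_ofReal_mul_I _).le)

theorem abs_integral_sin_le {X : Ω → ℝ} (hX : AEMeasurable X P) (b s : ℝ) :
    |∫ ω, Real.sin (s * (X ω - b)) ∂P| ≤ ‖charFun (P.map X) s‖ := by
  have h1 := integral_im (integrable_exp_mul_sub hX b s)
  simp only [RCLike.im_eq_complex_im, Complex.exp_ofReal_mul_I_im] at h1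
  rw [h1, integral_exp_sub_div hX]
  refine (Complex.abs_im_le_norm _).trans (le_of_eq ?_)
  rw [norm_mul, Complex.norm_exp_ofReal_mul_I, one_mul]

theorem abs_integral_cos_le {X : Ω → ℝ} (hX : AEMeasurable X P) (b s : ℝ) :
    |∫ ω, Real.cos (s * (X ω - b)) ∂P| ≤ ‖charFun (P.map X) s‖ := by
  have h1 := integral_re (integrable_exp_mul_sub hX b s)
  simp only [RCLike.re_eq_complex_re, Complex.exp_ofReal_mul_I_re] at h1
  rw [h1, integral_exp_sub_div hX]
  refine (Complex.abs_re_le_norm _).trans (le_of_eq ?_)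
  rw [norm_mul, Complex.norm_exp_ofReal_mul_I, one_mul]

/-- The variance of a high frequency sinusoid of a variable whose characteristic function vanishes
at infinity tends to `1 / 2`. -/
theorem tendsto_variance_sin {X : Ω → ℝ} (hX : AEMeasurable X P)
    (hchar : Tendsto (charFun (P.map X)) atTop (𝓝 0)) {s : ℕ → ℝ} (hs : Tendsto s atTop atTop)
    (b : ℝ) :
    Tendsto (fun n => Var[fun ω => Real.sin (s n * (X ω - b)); P]) atTop (𝓝 (1 / 2)) := by
  have hsin (n : ℕ) : AEStronglyMeasurable (fun ω => Real.sin (s n * (X ω - b))) P :=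
    (Measurable.comp_aemeasurable (g := fun x : ℝ => Real.sin (s n * (x - b)))
      (by fun_prop) hX).aestronglyMeasurable
  have hcos (n : ℕ) : Integrable (fun ω => Real.cos (2 * s n * (X ω - b))) P :=
    .of_bound (Measurable.comp_aemeasurable (g := fun x : ℝ => Real.cos (2 * s n * (x - b)))
      (by fun_prop) hX).aestronglyMeasurable 1
      (Eventually.of_forall fun ω => Real.abs_cos_le_one _)
  -- From `sin² = (1 - cos 2·) / 2`, both means that appear are bounded by the characteristic
  -- function, at frequencies `2 s` and `s`.
  have hvar (n : ℕ) : Var[fun ω => Real.sin (s n * (X ω - b)); P] =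
      1 / 2 - (1 / 2) * (∫ ω, Real.cos (2 * s n * (X ω - b)) ∂P) -
        (∫ ω, Real.sin (s n * (X ω - b)) ∂P) ^ 2 := by
    rw [variance_eq_sub (MemLp.of_bound (hsin n) 1
      (Eventually.of_forall fun ω => Real.abs_sin_le_one _))]
    congr 1
    have : ∀ ω, ((fun ω => Real.sin (s n * (X ω - b))) ^ 2) ω =
        1 / 2 - (1 / 2) * Real.cos (2 * s n * (X ω - b)) := fun ω => by
      simp only [Pi.pow_apply]
      rw [Real.sin_sq_eq_half_sub, mul_assoc]
      ring
    simp only [this]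
    rw [integral_sub (integrable_const _) ((hcos n).const_mul _), integral_const_mul]
    simp
  have h1 : Tendsto (fun n => ∫ ω, Real.sin (s n * (X ω - b)) ∂P) atTop (𝓝 0) :=
    squeeze_zero_norm (fun n => abs_integral_sin_le hX b (s n))
      (by simpa using (hchar.comp hs).norm)
  have h2 : Tendsto (fun n => ∫ ω, Real.cos (2 * s n * (X ω - b)) ∂P) atTop (𝓝 0) :=
    squeeze_zero_norm (fun n => abs_integral_cos_le hX b (2 * s n))
      (by simpa using (hchar.comp (hs.const_mul_atTop two_pos)).norm)
  simp only [hvar]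
  have h3 := ((h2.const_mul (1 / 2)).const_sub (1 / 2)).sub (h1.pow 2)
  rwa [show (1 / 2 - 1 / 2 * 0 - 0 ^ 2 : ℝ) = 1 / 2 by norm_num] at h3

end

/-- By independence the normalised centred sum has the variance of one term, which is at most its
second moment; Chebyshev's inequality concludes. -/
theorem tendstoInMeasure_inv_sqrt_mul_sum {Ω : Type*} [MeasurableSpace Ω] {P : Measure Ω}
    [IsProbabilityMeasure P] {X : ℕ → Ω → ℝ} (hindep : iIndepFun X P)
    (hident : ∀ i, IdentDistrib (X i) (X 0) P P) {g : ℕ → ℝ → ℝ} (hg : ∀ n, Measurable (g n))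
    (hmem : ∀ n, MemLp (fun ω => g n (X 0 ω)) 2 P)
    (hlim : Tendsto (fun n => ∫ ω, g n (X 0 ω) ^ 2 ∂P) atTop (𝓝 0)) :
    TendstoInMeasure P (fun (n : ℕ) ω =>
      (√(n : ℝ))⁻¹ * ∑ j ∈ Finset.range n, (g n (X j ω) - ∫ ω', g n (X 0 ω') ∂P))
      atTop 0 := by
  have hid (n i : ℕ) : IdentDistrib (fun ω => g n (X i ω)) (fun ω => g n (X 0 ω)) P P :=
    (hident i).comp (hg n)
  have hmem' (n i : ℕ) : MemLp (fun ω => g n (X i ω)) 2 P := (hid n i).memLp_iff.mpr (hmem n)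
  have hsum (n : ℕ) : MemLp (∑ j ∈ Finset.range n, fun ω => g n (X j ω)) 2 P :=
    memLp_finsetSum' _ fun j _ => hmem' n j
  have hvar (n : ℕ) : Var[∑ j ∈ Finset.range n, fun ω => g n (X j ω); P] =
      n * Var[fun ω => g n (X 0 ω); P] := by
    rw [IndepFun.variance_sum (fun j _ => hmem' n j) fun i _ j _ hij =>
      (hindep.indepFun hij).comp (hg n) (hg n)]
    simp [fun i => (hid n i).variance_eq]
  have hmean (n : ℕ) : ∫ ω, (∑ j ∈ Finset.range n, fun ω => g n (X j ω)) ω ∂P =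
      n * ∫ ω, g n (X 0 ω) ∂P := by
    simp only [Finset.sum_apply]
    rw [integral_finsetSum _ fun j _ => (hmem' n j).integrable one_le_two]
    simp [fun i => (hid n i).integral_eq]
  rw [tendstoInMeasure_iff_norm]
  intro ε hε
  have hup : Tendsto (fun n => ENNReal.ofReal ((∫ ω, g n (X 0 ω) ^ 2 ∂P) / ε ^ 2)) atTop
      (𝓝 0) := by
    simpa using ENNReal.tendsto_ofReal (hlim.div_const (ε ^ 2))
  refine tendsto_of_tendsto_of_tendsto_of_le_of_le' tendsto_const_nhds hup
    (Eventually.of_forall fun _ => zero_le) ?_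
  filter_upwards [eventually_gt_atTop 0] with n hn0
  have hn : (0 : ℝ) < n := Nat.cast_pos.mpr hn0
  have hs : 0 < √(n : ℝ) := Real.sqrt_pos.mpr hn
  have hset : {ω | ε ≤ ‖(√(n : ℝ))⁻¹ * ∑ j ∈ Finset.range n,
        (g n (X j ω) - ∫ ω', g n (X 0 ω') ∂P) - (0 : Ω → ℝ) ω‖} =
      {ω | √n * ε ≤ |(∑ j ∈ Finset.range n, fun ω => g n (X j ω)) ω -
        ∫ ω, (∑ j ∈ Finset.range n, fun ω => g n (X j ω)) ω ∂P|} := by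
    ext ω
    rw [Set.mem_ofPred_eq, Set.mem_ofPred_eq, hmean]
    simp only [Finset.sum_apply, Finset.sum_sub_distrib, Finset.sum_const, Finset.card_range,
      nsmul_eq_mul, Pi.zero_apply, sub_zero, norm_mul, norm_inv, Real.norm_eq_abs, abs_of_pos hs]
    rw [inv_mul_eq_div, le_div_iff₀ hs, mul_comm]
  rw [hset]
  refine (meas_ge_le_variance_div_sq (hsum n) (by positivity)).trans
    (ENNReal.ofReal_le_ofReal ?_)
  rw [hvar, mul_pow, Real.sq_sqrt hn.le, mul_div_mul_left _ _ hn.ne']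
  gcongr
  exact variance_le_expectation_sq (hmem n).aestronglyMeasurable

end Deconvolution

/-! ### Assembly of the limit theorem. -/

open Deconvolution

theorem mainTheorem4
    {Ω : Type*} [MeasurableSpace Ω] (P : Measure Ω) [IsProbabilityMeasure P]
    -- the kernel, its characteristic function and the condition on it
    (w φ : ℝ → ℝ) (A α : ℝ)
    (hw : Deconvolution.IsKernelCharFun w φ) (hφ : Deconvolution.ConditionW φ A α)
    -- the observations `X = Y + Z`
    (X Y Z : ℕ → Ω → ℝ)
    (hY_meas : ∀ i, Measurable (Y i)) (hZ_meas : ∀ i, Measurable (Z i))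
    (hX : ∀ i ω, X i ω = Y i ω + Z i ω)
    (hY_density : ∀ i, HasPDF (Y i) P volume)
    (hZ_normal : ∀ i, HasLaw (Z i) (gaussianReal 0 1) P)
    (hYZ_indep : ∀ i, IndepFun (Y i) (Z i) P)
    (hX_indep : iIndepFun X P) (hX_ident : ∀ i, IdentDistrib (X i) (X 0) P P)
    (hX_sq : Integrable (fun ω => X 0 ω ^ 2) P)
    -- the bandwidths and the end points of the intervals
    (h a : ℕ → ℝ) (b δ : ℝ)
    (hh_pos : ∀ n, 0 < h n) (hh_lim : Tendsto h atTop (𝓝 0))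
    (ha_lim : Tendsto a atTop atBot)
    (hah_lim : Tendsto (fun n => a n * h n) atTop atBot)
    (hδ_pos : 0 < δ) (hδ_lt : δ < 1)
    (ha_rate : a =o[atTop] fun n => Real.exp (1 / (2 * h n ^ 2) * (1 - δ))) :
    (∀ n, Integrable (fun ω => Deconvolution.intervalEstimator φ (gaussianReal 0 1) n (h n) (a n) b
        (fun j => X j ω)) P) ∧
    TendstoInDistribution
      (fun (n : ℕ) ω =>
        √(n : ℝ) / (h n ^ (2 + 2 * α) * Real.exp (1 / (2 * h n ^ 2))) *
          (Deconvolution.intervalEstimator φ (gaussianReal 0 1) n (h n) (a n) b (fun j => X j ω) -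
            ∫ ω', Deconvolution.intervalEstimator φ (gaussianReal 0 1) n (h n) (a n) b
              (fun j => X j ω') ∂P))
      atTop id (fun _ => P)
      (gaussianReal 0
        (A ^ 2 / (2 * Real.pi ^ 2) * Real.Gamma (α + 1) ^ 2).toNNReal) := by
  have hφi := hw.integrable
  have hα := hφ.nonneg
  have hXm (i : ℕ) : AEMeasurable (X i) P := (hX_ident i).aemeasurable_fst
  set γ := gaussianReal 0 1
  -- The amplitude of the limiting sinusoid; the limit variance is `κ² / 2`.
  set κ : ℝ := A * Real.Gamma (α + 1) / Real.pi
  set f : ℕ → ℝ → ℝ := fun n x => -κ * Real.sin (1 / h n * (x - b))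
  set g : ℕ → ℝ → ℝ := fun n => remainder φ A α (h n) (a n) b
  set S : ℕ → ℝ → ℝ := fun n => summand φ (h n) (a n) b
  have hfm (n : ℕ) : Measurable (f n) := by fun_prop
  have hgm (n : ℕ) : Measurable (g n) := (continuous_remainder hφi A α (h n) (a n) b).measurable
  have hfC (n : ℕ) (x : ℝ) : |f n x| ≤ |κ| := by
    rw [abs_mul, abs_neg]
    exact mul_le_of_le_one_right (abs_nonneg _) (Real.abs_sin_le_one _)
  have hS (n : ℕ) (x : ℝ) : S n x = rate α (h n) * (f n x + g n x) := by
    have := (rate_pos α (hh_pos n)).ne'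
    simp only [S, f, g, remainder, one_div_mul_eq_div, κ]
    field_simp
    ring
  have hest (n : ℕ) (x : ℕ → ℝ) : intervalEstimator φ γ n (h n) (a n) b x =
      (1 / (n : ℝ)) * ∑ j ∈ Finset.range n, S n (x j) :=
    intervalEstimator_gaussian hφi hφ.symm hφ.support (hh_pos n) n (a n) b x
  obtain ⟨σ, hσ, hbd⟩ := exists_remainder_bound hφi hα hφ.expansion b hh_pos hh_lim hδ_pos
    hδ_lt ha_rate
  obtain ⟨hgL, hglim⟩ := tendsto_integral_remainder_sq (hXm 0) hX_sq hφi hα hh_lim hah_lim hσ hbd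
  have hfi (n : ℕ) : Integrable (fun ω => f n (X 0 ω)) P :=
    .of_bound ((hfm n).comp_aemeasurable (hXm 0)).aestronglyMeasurable |κ|
      (Eventually.of_forall fun ω => hfC n _)
  have hgi (n : ℕ) : Integrable (fun ω => g n (X 0 ω)) P := (hgL n).integrable one_le_two
  have hSm (n : ℕ) : Measurable (S n) := by
    rw [funext (hS n)]
    exact ((hfm n).add (hgm n)).const_mul _
  have hSi (n j : ℕ) : Integrable (fun ω => S n (X j ω)) P := by
    refine ((hX_ident j).comp (hSm n)).integrable_iff.mpr ?_
    have : S n ∘ X 0 = fun ω => rate α (h n) * (f n (X 0 ω) + g n (X 0 ω)) :=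
      funext fun ω => hS n _
    rw [this]
    exact ((hfi n).add (hgi n)).const_mul _
  have hSmean (n j : ℕ) : ∫ ω, S n (X j ω) ∂P =
      rate α (h n) * ((∫ ω, f n (X 0 ω) ∂P) + ∫ ω, g n (X 0 ω) ∂P) := by
    rw [← integral_add (hfi n) (hgi n), ← integral_const_mul]
    simp only [← hS]
    exact ((hX_ident j).comp (hSm n)).integral_eq
  have hint (n : ℕ) : Integrable (fun ω => intervalEstimator φ γ n (h n) (a n) b
      (fun j => X j ω)) P := by
    simp only [hest]
    exact (integrable_finsetSum _ fun j _ => hSi n j).const_mul _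
  refine ⟨hint, ?_⟩
  have hchar : Tendsto (charFun (P.map (X 0))) atTop (𝓝 0) := by
    have h0 : X 0 = fun ω => Y 0 ω + Z 0 ω := funext (hX 0)
    rw [h0]
    refine squeeze_zero_norm (fun t => norm_charFun_add_gaussian_le (hY_meas 0) (hZ_meas 0)
      (hZ_normal 0) (hYZ_indep 0) t) ?_
    exact Real.tendsto_exp_neg_atTop_nhds_zero.comp
      ((tendsto_pow_atTop two_ne_zero).atTop_div_const two_pos)
  have hinv : Tendsto (fun n => 1 / h n) atTop atTop := by
    simp only [one_div]
    exact tendsto_inv_nhdsGT_zero.comp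
      (tendsto_nhdsWithin_iff.mpr ⟨hh_lim, Eventually.of_forall hh_pos⟩)
  have hvar : Tendsto (fun n => Var[fun ω => f n (X 0 ω); P]) atTop
      (𝓝 ((A ^ 2 / (2 * Real.pi ^ 2) * Real.Gamma (α + 1) ^ 2).toNNReal : ℝ)) := by
    have h1 := (tendsto_variance_sin (hXm 0) hchar hinv b).const_mul ((-κ) ^ 2)
    rw [Real.coe_toNNReal _ (by positivity)]
    have e : (-κ) ^ 2 * (1 / 2) = A ^ 2 / (2 * Real.pi ^ 2) * Real.Gamma (α + 1) ^ 2 := by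
      simp only [κ]
      field_simp
    rw [e] at h1
    exact h1.congr fun n => (variance_const_mul _ _ _).symm
  have hclt := tendstoInDistribution_inv_sqrt_mul_sum_of_bounded hX_indep hX_ident hfm hfC hvar
  have hrem := tendstoInMeasure_inv_sqrt_mul_sum hX_indep hX_ident hgm hgL hglim
  -- Slutsky: the difference from the normalised sum of sinusoids is exactly the normalised sum of
  -- remainders.
  refine tendstoInDistribution_of_tendstoInMeasure_sub _ _ hclt ?_
    fun n => ((hint n).aemeasurable.sub_const _).const_mul _
  convert hrem using 1
  funext n ω
  simp only [Pi.sub_apply, hest]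
  rw [integral_const_mul, integral_finsetSum _ fun j _ => hSi n j]
  simp only [hSmean]
  simp only [hS, ← Finset.mul_sum, Finset.sum_sub_distrib, Finset.sum_add_distrib,
    Finset.sum_const, Finset.card_range, nsmul_eq_mul]
  have hr : h n ^ (2 + 2 * α) * Real.exp (1 / (2 * h n ^ 2)) = rate α (h n) := rfl
  have hr0 := (rate_pos α (hh_pos n)).ne'
  -- Writing `(√n)⁻¹` as `√n / n` is valid at `n = 0` too, so no case split is needed.
  rw [hr, ← Real.sqrt_div_self]
  field_simp
  ring
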